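/- Let $a<b$. A 2-ribbon surface over $[a,b]$ is a triple $f=(f_0,f_1,f_2)$ of curves $f_i:[a,b]\to\mathbb R^3$ with $f_0,f_2$ of class $C^1$ and $f_1$ of class $C^2$; write $\dot f_i$ for the derivative in $t\in[a,b]$ and $\Delta f_i=f_{i+1}-f_i$ ($i=0,1$). These triples form the Banach space $X=C^1([a,b],\mathbb R^3)\times C^2([a,b],\mathbb R^3)\times C^1([a,b],\mathbb R^3)$. A flexion of $f$ of class $C^k$ ($k\in\{0,1,2,\dots,\infty\}$) on a parameter interval $S\ni 0$ is a $C^k$ curve $\gamma:S\to X$ with $\gamma(0)=f$ along which the functions of $t$ $$|\dot f_0|,\ |\dot f_1|,\ |\dot f_2|,\quad |\Delta f_i|,\quad \langle \dot f_i,\Delta f_i\rangle,\quad \langle \dot f_{i+1},\Delta f_i\rangle,\quad \langle \dot f_i,\dot f_{i+1}\rangle\qquad(i=0,1)$$ are preserved. Two 2-ribbon surfaces are congruent if some isometry of $\mathbb R^3$ carries the curves of one to the corresponding curves of the other. Theorem. Let $f$ be a 2-ribbon surface whose mixed product $(\dot f_1,\Delta f_0,\Delta f_1)$ has no zeros on $[a,b]$.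 Then $f$ is finitely flexible, and the set of its flexions up to isometries is one-dimensional. Precisely, there are $\rho>0$ and a flexion $\Gamma:(-\rho,\rho)\to X$ of $f$ of class $C^\infty$ such that (i) for $s\ne s'$ in $(-\rho,\rho)$ the surfaces $\Gamma(s)$ and $\Gamma(s')$ are not congruent; (ii) for every $k\in\{0,1,2,\dots,\infty\}$, every $\varepsilon>0$ and every flexion $\gamma:[0,\varepsilon]\to X$ of $f$ of class $C^k$ there are $\delta\in(0,\varepsilon]$ and a $C^k$ function $\varphi:[0,\delta]\to(-\rho,\rho)$ with $\varphi(0)=0$ such that $\gamma(s)$ is congruent to $\Gamma(\varphi(s))$ for all $s\in[0,\delta]$. -/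

import Mathlib

open Set
open scoped ContDiff

/-- The order of smoothness of the three boundary curves `f₀, f₁, f₂` of a 2-ribbon surface:
`f₀` and `f₂` are of class `C¹`, the middle curve `f₁` is of class `C²`. -/
def ribbonOrder : Fin 3 → ℕ := ![1, 2, 1]

/-- A 2-ribbon surface over the segment `[a, b]`: three curves `f₀, f₁, f₂ : [a, b] → ℝ³`, with
`f₀, f₂` of class `C¹` and `f₁` of class `C²`. Only the values on `[a, b]` matter. -/
structure TwoRibbonSurface (a b : ℝ) where
  lt : a < b
  curve : Fin 3 → ℝ → EuclideanSpace ℝ (Fin 3)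
  contDiffOn : ∀ i, ContDiffOn ℝ (ribbonOrder i) (curve i) (Icc a b)

namespace TwoRibbonSurface

variable {a b : ℝ}

/-- The velocity of the `i`-th curve (one-sided at the endpoints of `[a, b]`). -/
noncomputable def vel (f : TwoRibbonSurface a b) (i : Fin 3) (t : ℝ) :
    EuclideanSpace ℝ (Fin 3) :=
  derivWithin (f.curve i) (Icc a b) t

/-- The difference `Δfᵢ = fᵢ₊₁ - fᵢ`, for `i = 0, 1`. -/
noncomputable def diff (f : TwoRibbonSurface a b) (i : Fin 2) (t : ℝ) :
    EuclideanSpace ℝ (Fin 3) :=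
  f.curve i.succ t - f.curve i.castSucc t

/-- The `j`-th derivative of the `i`-th curve, as an element of the Banach space
`C([a, b], ℝ³)` with the supremum norm. -/
noncomputable def jet (f : TwoRibbonSurface a b) (i : Fin 3) (j : Fin (ribbonOrder i + 1)) :
    C(Icc a b, EuclideanSpace ℝ (Fin 3)) where
  toFun t := iteratedDerivWithin j (f.curve i) (Icc a b) t
  continuous_toFun := by
    have h := (f.contDiffOn i).continuousOn_iteratedDerivWithin (m := (j : ℕ))
      (by exact_mod_cast Nat.lt_succ_iff.mp j.isLt) (uniqueDiffOn_Icc f.lt)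
    exact continuousOn_iff_continuous_domRestrict.mp h

/-- Two surfaces have the same inner geometry: the quantities `|ḟᵢ|`, `|Δfᵢ|`, `⟨ḟᵢ, Δfᵢ⟩`,
`⟨ḟᵢ, Δfᵢ₋₁⟩` and `⟨ḟᵢ, ḟᵢ₊₁⟩` agree for all admissible `i` at every point of `[a, b]`. -/
def SameInnerGeometry (f g : TwoRibbonSurface a b) : Prop :=
  ∀ t ∈ Icc a b,
    (∀ i : Fin 3, ‖g.vel i t‖ = ‖f.vel i t‖) ∧
    ∀ i : Fin 2,
      ‖g.diff i t‖ = ‖f.diff i t‖ ∧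
      inner ℝ (g.vel i.castSucc t) (g.diff i t) = inner ℝ (f.vel i.castSucc t) (f.diff i t) ∧
      inner ℝ (g.vel i.succ t) (g.diff i t) = inner ℝ (f.vel i.succ t) (f.diff i t) ∧
      inner ℝ (g.vel i.castSucc t) (g.vel i.succ t) =
        inner ℝ (f.vel i.castSucc t) (f.vel i.succ t)

/-- Two surfaces differ by an isometry of `ℝ³`. -/
def IsCongruent (f g : TwoRibbonSurface a b) : Prop :=
  ∃ T : EuclideanSpace ℝ (Fin 3) ≃ᵢ EuclideanSpace ℝ (Fin 3),
    ∀ i, ∀ t ∈ Icc a b, g.curve i t = T (f.curve i t)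

/-- The curve `s ↦ γ s` is of class `Cᵏ` on `S`, as a curve in the Banach space
`C¹([a, b], ℝ³) × C²([a, b], ℝ³) × C¹([a, b], ℝ³)` of all 2-ribbon surfaces. This space is
embedded by `jet`, as a closed subspace, in a finite power of `C([a, b], ℝ³)`. -/
def IsCurveOfClass (k : WithTop ℕ∞) (γ : ℝ → TwoRibbonSurface a b) (S : Set ℝ) : Prop :=
  ∀ i j, ContDiffOn ℝ k (fun s => (γ s).jet i j) S

/-- `γ` is a flexion of class `Cᵏ` of the surface `f`, with parameter running through `S`
(a set that contains `0`): a curve of class `Cᵏ` of 2-ribbon surfaces that starts from `f` at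
parameter `0` and does not change the inner geometry. -/
structure IsFlexion (f : TwoRibbonSurface a b) (k : WithTop ℕ∞) (S : Set ℝ)
    (γ : ℝ → TwoRibbonSurface a b) : Prop where
  start : ∀ i, EqOn ((γ 0).curve i) (f.curve i) (Icc a b)
  smooth : IsCurveOfClass k γ S
  isometric : ∀ s ∈ S, SameInnerGeometry f (γ s)

end TwoRibbonSurface

/-- The mixed product `(u, v, w)` of three vectors of `ℝ³`. -/
noncomputable def mixedProduct (u v w : EuclideanSpace ℝ (Fin 3)) : ℝ :=
  Matrix.det (Matrix.of fun i j : Fin 3 => (![u, v, w] i) j)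

/-! Write Y = (ḟ₁, Δf₀, Δf₁); the hypothesis says that Y(t) is always a basis. Then Y' is encoded by
nine scalars: the products of f̈₁ with the basis, and those of Δḟᵢ with ḟ₁, Δfᵢ and ḟ₁ × Δfᵢ. The
products with the cross products are used because ⟨Δḟ₀, Δf₁⟩ and ⟨Δḟ₁, Δf₀⟩ are not part of the
inner geometry. The inner geometry fixes seven of the scalars and, through Gram determinants, the
squares of the other two. Along a continuous flexion no sign can jump, so at each t all nine stay
constant (`IsFlexion.ribbonCoeff_eq`).

Hence the moving bases of a flexion all solve one equation Y' = W(c(t), Y), with c fixed by f, and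
are determined by Y(a). Up to rotation, Y(a) is its Gram matrix with an orientation, and the only
entry left free is ⟨Δf₀, Δf₁⟩(a). Conversely, a solution with the right other five entries at a has
the inner geometry of f (`sameInnerGeometry_of_ribbonCoeff_eq`). So this one number is the parameter
of Γ and gives φ; being expressible by distances, it separates congruence classes.

Smoothness in the Banach space comes from the inverse function theorem for Y ↦ Y - ∫ W(c, Y) on
continuous maps (`exists_contDiffOn_integral_curves`). Its derivative is the identity minus a
Volterra operator, hence invertible on the whole segment. Since Y' = W(c, Y) also varies smoothly in
the supremum norm, so do the derivatives of the three curves. -/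

/-! ### Smoothness of superposition operators -/

section Superposition

open ContinuousMap Filter Topology

variable {K E F : Type} [TopologicalSpace K] [NormedAddCommGroup E] [NormedAddCommGroup F]

open Classical in
/-- The superposition operator `f ↦ W ∘ f` on continuous maps, with value `0` where `W ∘ f` is not
continuous. -/
noncomputable def superpose (W : E → F) (f : C(K, E)) : C(K, F) :=
  if h : Continuous (W ∘ f) then ⟨W ∘ f, h⟩ else 0

theorem superpose_apply {W : E → F} {U : Set E} (hW : ContinuousOn W U) {f : C(K, E)}
    (hf : ∀ t, f t ∈ U) (t : K) : superpose W f t = W (f t) := by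
  have h : Continuous (W ∘ f) := hW.comp_continuous f.continuous hf
  simp [superpose, h]

variable [CompactSpace K]

theorem isOpen_forall_mem {U : Set E} (hU : IsOpen U) : IsOpen {f : C(K, E) | ∀ t, f t ∈ U} := by
  simpa [MapsTo] using isOpen_setOfPred_mapsTo (X := K) isCompact_univ hU

theorem continuousOn_superpose {W : E → F} {U : Set E} (hU : IsOpen U) (hW : ContinuousOn W U) :
    ContinuousOn (superpose W : C(K, E) → C(K, F)) {f | ∀ t, f t ∈ U} := by
  intro f hf
  apply ContinuousAt.continuousWithinAt
  rw [ContinuousAt, tendsto_nhds_compactOpen]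
  intro L hL V hV hfV
  have hUV : IsOpen (U ∩ W ⁻¹' V) := hW.isOpen_inter_preimage hU hV
  have h1 : MapsTo f L (U ∩ W ⁻¹' V) := fun t ht => by
    refine ⟨hf t, ?_⟩
    have := hfV ht
    rwa [superpose_apply hW hf] at this
  filter_upwards [eventually_mapsTo hL hUV h1, (isOpen_forall_mem hU).mem_nhds hf] with g hg hgU
  intro t ht
  rw [superpose_apply hW hgU]
  exact (hg ht).2

variable [NormedSpace ℝ E] [NormedSpace ℝ F]

/-- Pointwise application of a continuous family of operators to a continuous map. -/
noncomputable def pointwiseApply :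
    C(K, E →L[ℝ] F) →L[ℝ] C(K, E) →L[ℝ] C(K, F) :=
  LinearMap.mkContinuous₂
    (LinearMap.mk₂ ℝ (fun (A : C(K, E →L[ℝ] F)) (h : C(K, E)) =>
        (⟨fun t => A t (h t), A.continuous.clm_apply h.continuous⟩ : C(K, F)))
      (fun _ _ _ => by ext; simp) (fun _ _ _ => by ext; simp) (fun _ _ _ => by ext; simp)
      (fun _ _ _ => by ext; simp)) 1 (fun A h => by
        rw [one_mul]
        refine (ContinuousMap.norm_le _ (by positivity)).2 fun t => ?_
        exact ((A t).le_opNorm _).trans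
          (mul_le_mul (A.norm_coe_le_norm t) (h.norm_coe_le_norm t) (by positivity)
            (by positivity)))

@[simp]
theorem pointwiseApply_apply (A : C(K, E →L[ℝ] F)) (h : C(K, E)) (t : K) :
    pointwiseApply A h t = A t (h t) := rfl

/-- The mean value inequality is applied at each t. The radius δ does not depend on t because
superposition with `fderiv ℝ W` is continuous in the supremum norm. -/
theorem hasFDerivAt_superpose {W : E → F} {U : Set E} (hU : IsOpen U)
    (hW : DifferentiableOn ℝ W U) (hW' : ContinuousOn (fderiv ℝ W) U) {f : C(K, E)}
    (hf : ∀ t, f t ∈ U) :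
    HasFDerivAt (superpose W : C(K, E) → C(K, F))
      (pointwiseApply (superpose (fderiv ℝ W) f)) f := by
  rw [hasFDerivAt_iff_isLittleO_nhds_zero, Asymptotics.isLittleO_iff]
  intro ε hε
  have hO := (isOpen_forall_mem (K := K) hU).mem_nhds hf
  have hc := (continuousOn_superpose hU hW').continuousAt hO
  obtain ⟨δ, hδ, hball⟩ := Metric.eventually_nhds_iff_ball.1
    ((Metric.continuousAt_iff'.1 hc ε hε).and hO)
  filter_upwards [Metric.ball_mem_nhds (0 : C(K, E)) hδ] with h hh
  rw [mem_ball_zero_iff] at hh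
  have hball' : ∀ g : C(K, E), ‖g - f‖ < δ → _ := fun g hg => hball g (by
    rwa [Metric.mem_ball, dist_eq_norm])
  refine (ContinuousMap.norm_le _ (by positivity)).2 fun t => ?_
  have hfh := (hball' (f + h) (by simpa using hh)).2
  have key : ∀ y ∈ Metric.ball (f t) δ, y ∈ U ∧ ‖fderiv ℝ W y - fderiv ℝ W (f t)‖ ≤ ε := by
    intro y hy
    -- Translating f by a constant gives a map that is close to f and takes the value y at t, so a
    -- bound in the supremum norm becomes a bound at the point y.
    have hn : ‖(f + const K (y - f t)) - f‖ < δ := by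
      rw [add_sub_cancel_left]
      refine lt_of_le_of_lt ?_ (mem_ball_iff_norm.1 hy)
      exact (ContinuousMap.norm_le _ (norm_nonneg _)).2 fun _ => le_rfl
    obtain ⟨h1, h2⟩ := hball' _ hn
    have hyU : y ∈ U := by simpa using h2 t
    refine ⟨hyU, ?_⟩
    have h3 := (ContinuousMap.dist_apply_le_dist t).trans h1.le
    rw [superpose_apply hW' hf, superpose_apply hW' h2, dist_eq_norm] at h3
    simpa using h3
  have hmem : f t + h t ∈ Metric.ball (f t) δ := by
    rw [mem_ball_iff_norm, add_sub_cancel_left]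
    exact (h.norm_coe_le_norm t).trans_lt hh
  have := (convex_ball (f t) δ).norm_image_sub_le_of_norm_hasFDerivWithin_le'
    (f := W) (f' := fderiv ℝ W) (φ := fderiv ℝ W (f t)) (C := ε)
    (fun y hy => ((hW y (key y hy).1).differentiableAt
      (hU.mem_nhds (key y hy).1)).hasFDerivAt.hasFDerivWithinAt)
    (fun y hy => (key y hy).2) (Metric.mem_ball_self hδ) hmem
  simp only [ContinuousMap.sub_apply, pointwiseApply_apply, superpose_apply hW.continuousOn hfh,
    superpose_apply hW.continuousOn hf, superpose_apply hW' hf, ContinuousMap.add_apply]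
  rw [add_sub_cancel_left] at this
  exact this.trans (mul_le_mul_of_nonneg_left (h.norm_coe_le_norm t) hε.le)

/-- The derivative is again a superposition operator followed by a continuous linear map. The target
space is quantified inside the induction because `fderiv ℝ W` takes values in a space of operators.
-/
theorem contDiffOn_superpose_nat {U : Set E} (hU : IsOpen U) (n : ℕ) :
    ∀ {F : Type} [NormedAddCommGroup F] [NormedSpace ℝ F] {W : E → F}, ContDiffOn ℝ n W U →
      ContDiffOn ℝ n (superpose W : C(K, E) → C(K, F)) {f | ∀ t, f t ∈ U} := by
  induction n with
  | zero =>
    intro F _ _ W hW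
    exact contDiffOn_zero.2 (continuousOn_superpose hU hW.continuousOn)
  | succ n ih =>
    intro F _ _ W hW
    have hW1 := hW
    push_cast at hW hW1 ⊢
    rw [contDiffOn_succ_iff_fderiv_of_isOpen hU] at hW
    obtain ⟨hd, -, hc⟩ := hW
    have hder : ∀ f : C(K, E), (∀ t, f t ∈ U) → HasFDerivAt (superpose W : C(K, E) → C(K, F))
      (pointwiseApply (superpose (fderiv ℝ W) f)) f := fun f hf =>
        hasFDerivAt_superpose hU hd hc.continuousOn hf
    rw [contDiffOn_succ_iff_fderiv_of_isOpen (isOpen_forall_mem hU)]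
    refine ⟨fun f hf => (hder f hf).differentiableAt.differentiableWithinAt, by simp, ?_⟩
    refine ContDiffOn.congr (f := fun f => pointwiseApply (superpose (fderiv ℝ W) f)) ?_
      fun f hf => (hder f hf).fderiv
    exact (ContinuousLinearMap.contDiff _).comp_contDiffOn (ih hc)

theorem contDiffOn_superpose {U : Set E} (hU : IsOpen U) {W : E → F} (hW : ContDiffOn ℝ ∞ W U) :
    ContDiffOn ℝ ∞ (superpose W : C(K, E) → C(K, F)) {f | ∀ t, f t ∈ U} :=
  contDiffOn_infty.2 fun n => contDiffOn_superpose_nat hU n (contDiffOn_infty.1 hW n)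

end Superposition

/-! ### Invertibility of identity minus a Volterra operator -/

section Volterra

variable {a b : ℝ} {E : Type} [NormedAddCommGroup E] [NormedSpace ℝ E]

/-- The operator that maps `h` to its primitive vanishing at `a`. -/
noncomputable def primitive (hab : a ≤ b) : C(Icc a b, E) →L[ℝ] C(Icc a b, E) :=
  have hc : ∀ h : C(Icc a b, E), Continuous (IccExtend hab h) := fun h => h.continuous.Icc_extend'
  LinearMap.mkContinuous
    { toFun := fun h => ⟨fun t => ∫ τ in a..(t : ℝ), IccExtend hab h τ, by
        have := intervalIntegral.continuous_primitive
          (fun x y => (hc h).intervalIntegrable (μ := MeasureTheory.volume) x y) a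
        exact this.comp continuous_subtype_val⟩
      map_add' := fun h k => by
        ext t
        simp only [ContinuousMap.coe_mk, ContinuousMap.add_apply]
        rw [← intervalIntegral.integral_add ((hc h).intervalIntegrable _ _)
          ((hc k).intervalIntegrable _ _)]
        rfl
      map_smul' := fun r h => by
        ext t
        simp only [ContinuousMap.coe_mk, ContinuousMap.smul_apply, RingHom.id_apply]
        rw [← intervalIntegral.integral_smul]
        rfl } (b - a) (fun h => by
      refine (ContinuousMap.norm_le _ (by have := sub_nonneg.2 hab; positivity)).2 fun t => ?_
      refine (intervalIntegral.norm_integral_le_of_norm_le_const (C := ‖h‖)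
        fun τ _ => h.norm_coe_le_norm _).trans ?_
      rw [abs_of_nonneg (sub_nonneg.2 t.2.1), mul_comm]
      gcongr
      exact t.2.2)

theorem primitive_apply (hab : a ≤ b) (h : C(Icc a b, E)) (t : Icc a b) :
    primitive hab h t = ∫ τ in a..(t : ℝ), IccExtend hab h τ := rfl

theorem hasDerivAt_integral_IccExtend [CompleteSpace E] (hab : a ≤ b) (h : C(Icc a b, E)) (t : ℝ) :
    HasDerivAt (fun s => ∫ τ in a..s, IccExtend hab h τ) (IccExtend hab h t) t := by
  have hc : Continuous (IccExtend hab h) := h.continuous.Icc_extend'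
  exact intervalIntegral.integral_hasDerivAt_right (hc.intervalIntegrable _ _)
    hc.stronglyMeasurable.stronglyMeasurableAtFilter hc.continuousAt

/-- Iterated integration produces the factorial. It is essential that L is bounded pointwise in t
and not only in norm. -/
theorem norm_primitive_comp_pow_apply_le (hab : a ≤ b) {L : C(Icc a b, E) →L[ℝ] C(Icc a b, E)}
    {M : ℝ} (hM : 0 ≤ M) (hL : ∀ h t, ‖L h t‖ ≤ M * ‖h t‖) (n : ℕ) (h : C(Icc a b, E))
    (t : Icc a b) :
    ‖(((primitive hab).comp L) ^ n) h t‖ ≤ (M * (t - a)) ^ n / n.factorial * ‖h‖ := by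
  induction n generalizing t with
  | zero => simpa using h.norm_coe_le_norm t
  | succ n ih =>
    rw [pow_succ', mul_apply_eq_comp, ContinuousLinearMap.comp_apply, primitive_apply]
    set g := (((primitive hab).comp L) ^ n) h
    have hb : ∀ τ ∈ Ioc a (t : ℝ), ‖IccExtend hab (L g) τ‖ ≤
        M * ((M * (τ - a)) ^ n / n.factorial * ‖h‖) := by
      intro τ hτ
      have hτ' : τ ∈ Icc a b := ⟨hτ.1.le, hτ.2.trans t.2.2⟩
      rw [IccExtend_of_mem hab _ hτ']
      exact (hL g ⟨τ, hτ'⟩).trans (mul_le_mul_of_nonneg_left (ih ⟨τ, hτ'⟩) hM)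
    have hd : ∀ τ : ℝ, HasDerivAt (fun x => (M * (x - a)) ^ (n + 1) / (n + 1).factorial * ‖h‖)
        (M * ((M * (τ - a)) ^ n / n.factorial * ‖h‖)) τ := by
      intro τ
      have h1 : HasDerivAt (fun x => M * (x - a)) M τ := by
        simpa using ((hasDerivAt_id τ).sub_const a).const_mul M
      refine (((h1.pow (n + 1)).div_const ((n + 1).factorial : ℝ)).mul_const ‖h‖).congr_deriv ?_
      rw [Nat.factorial_succ]
      have : (n.factorial : ℝ) ≠ 0 := by positivity
      push_cast
      field_simp
    have hcont : Continuous fun τ : ℝ => M * ((M * (τ - a)) ^ n / n.factorial * ‖h‖) := by fun_prop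
    refine (intervalIntegral.norm_integral_le_of_norm_le t.2.1
      (Filter.Eventually.of_forall hb) (hcont.intervalIntegrable _ _)).trans ?_
    rw [intervalIntegral.integral_eq_sub_of_hasDerivAt (fun τ _ => hd τ)
      (hcont.intervalIntegrable _ _)]
    simp

/-- T need not be a contraction, but some power is. Then 1 - T ^ n is invertible by the Neumann
series, and 1 - T is one of its two commuting factors. -/
theorem isUnit_one_sub_primitive_comp [CompleteSpace E] (hab : a ≤ b)
    {L : C(Icc a b, E) →L[ℝ] C(Icc a b, E)}
    {M : ℝ} (hM : 0 ≤ M) (hL : ∀ h t, ‖L h t‖ ≤ M * ‖h t‖) :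
    IsUnit (1 - (primitive hab).comp L) := by
  set T := (primitive hab).comp L
  have hlim := FloorSemiring.tendsto_pow_div_factorial_atTop (M * (b - a))
  obtain ⟨n, hn⟩ := (hlim.eventually (gt_mem_nhds one_pos)).exists
  have hba : 0 ≤ b - a := sub_nonneg.2 hab
  have hT : ‖T ^ n‖ < 1 := by
    refine lt_of_le_of_lt ?_ hn
    refine ContinuousLinearMap.opNorm_le_bound _ (by positivity) fun h => ?_
    refine (ContinuousMap.norm_le _ (by positivity)).2 fun t => ?_
    refine (norm_primitive_comp_pow_apply_le hab hM hL n h t).trans ?_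
    have h0 : 0 ≤ (t : ℝ) - a := sub_nonneg.2 t.2.1
    have h1 : (t : ℝ) ≤ b := t.2.2
    gcongr
  have hu : IsUnit (1 - T ^ n) := 
    isUnit_one_sub_of_norm_lt_one (R := C(Icc a b, E) →L[ℝ] C(Icc a b, E)) hT
  rw [← mul_neg_geom_sum T n] at hu
  have hcomm : Commute (1 - T) (∑ i ∈ Finset.range n, T ^ i) :=
    (Commute.sum_right _ _ _ fun i _ =>
      ((Commute.one_left (T ^ i)).sub_left (Commute.self_pow T i)))
  exact (hcomm.isUnit_mul_iff.1 hu).1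

end Volterra

/-! ### Smooth dependence of solutions on the initial value -/

section ParameterDependence

open ContinuousMap Filter Topology

variable {a b : ℝ} {P E : Type} [NormedAddCommGroup P] [NormedSpace ℝ P]
  [NormedAddCommGroup E] [NormedSpace ℝ E]

theorem contDiff_pairing_left {K : Type} [TopologicalSpace K] [CompactSpace K] (c : C(K, P)) :
    ContDiff ℝ ∞ (fun Y : C(K, E) => c.prodMk Y) ∧ ∀ Y : C(K, E),
      HasFDerivAt (fun Y : C(K, E) => c.prodMk Y)
        ((ContinuousLinearMap.inr ℝ P E).compLeftContinuous ℝ K) Y := by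
  have h : (fun Y : C(K, E) => c.prodMk Y) = fun Y =>
      c.prodMk (0 : C(K, E)) + (ContinuousLinearMap.inr ℝ P E).compLeftContinuous ℝ K Y := by
    ext Y t <;> simp
  rw [h]
  exact ⟨contDiff_const.add (ContinuousLinearMap.contDiff _),
    fun Y => (ContinuousLinearMap.hasFDerivAt _).const_add _⟩

/-- The integral operator whose value at a solution of `Y' = W (c, Y)` is the constant initial
value. -/
noncomputable def picardDefect (hab : a ≤ b) (W : P × E → E) (c : C(Icc a b, P))
    (Y : C(Icc a b, E)) : C(Icc a b, E) :=
  Y - primitive hab (superpose W (c.prodMk Y))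

theorem contDiffOn_picardDefect (hab : a ≤ b) {U : Set (P × E)} (hU : IsOpen U) {W : P × E → E}
    (hW : ContDiffOn ℝ ∞ W U) (c : C(Icc a b, P)) :
    ContDiffOn ℝ ∞ (picardDefect hab W c) {Y | ∀ t, (c t, Y t) ∈ U} := by
  have h : ContDiffOn ℝ ∞ (fun Y : C(Icc a b, E) => superpose W (c.prodMk Y))
      {Y | ∀ t, (c t, Y t) ∈ U} :=
    (contDiffOn_superpose hU hW).comp (contDiff_pairing_left c).1.contDiffOn fun Y hY => hY
  have h2 : ContDiff ℝ ∞ (primitive hab : C(Icc a b, E) →L[ℝ] C(Icc a b, E)) :=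
    ContinuousLinearMap.contDiff _
  exact contDiffOn_id.sub (h2.comp_contDiffOn h)

theorem isOpen_forall_prodMk_mem {U : Set (P × E)} (hU : IsOpen U) (c : C(Icc a b, P)) :
    IsOpen {Y : C(Icc a b, E) | ∀ t, (c t, Y t) ∈ U} :=
  (isOpen_forall_mem hU).preimage (contDiff_pairing_left (E := E) c).1.continuous

/-- The derivative is 1 minus the primitive of L, where L multiplies pointwise by the partial
derivative of W in its second argument. -/
theorem exists_equiv_hasFDerivAt_picardDefect [CompleteSpace E] (hab : a ≤ b) {U : Set (P × E)}
    (hU : IsOpen U) {W : P × E → E} (hW : ContDiffOn ℝ ∞ W U) (c : C(Icc a b, P))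
    {Y : C(Icc a b, E)} (hY : ∀ t, (c t, Y t) ∈ U) :
    ∃ e : C(Icc a b, E) ≃L[ℝ] C(Icc a b, E),
      HasFDerivAt (picardDefect hab W c) (e : C(Icc a b, E) →L[ℝ] C(Icc a b, E)) Y := by
  have hW' : ContinuousOn (fderiv ℝ W) U := hW.continuousOn_fderiv_of_isOpen hU (by simp)
  have hs : HasFDerivAt (superpose W : C(Icc a b, P × E) → C(Icc a b, E)) _ (c.prodMk Y) :=
    hasFDerivAt_superpose hU (hW.differentiableOn (by simp)) hW' hY
  set A := superpose (fderiv ℝ W) (c.prodMk Y)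
  set L : C(Icc a b, E) →L[ℝ] C(Icc a b, E) :=
    (pointwiseApply A).comp ((ContinuousLinearMap.inr ℝ P E).compLeftContinuous ℝ (Icc a b))
  have hL : ∀ h t, ‖L h t‖ ≤ ‖A‖ * ‖h t‖ := by
    intro h t
    have : L h t = A t (0, h t) := rfl
    rw [this]
    refine ((A t).le_opNorm _).trans ?_
    rw [show ‖((0 : P), h t)‖ = ‖h t‖ by simp [Prod.norm_def]]
    gcongr
    exact A.norm_coe_le_norm t
  obtain ⟨u, hu⟩ := isUnit_one_sub_primitive_comp hab (norm_nonneg A) hL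
  refine ⟨ContinuousLinearEquiv.unitsEquiv ℝ _ u, ?_⟩
  have h1 : HasFDerivAt (fun Y => superpose W (c.prodMk Y)) L Y :=
    hs.comp Y ((contDiff_pairing_left c).2 Y)
  have h2 := (hasFDerivAt_id Y).sub ((primitive hab).hasFDerivAt.comp Y h1)
  have h3 : ((ContinuousLinearEquiv.unitsEquiv ℝ _ u : C(Icc a b, E) ≃L[ℝ] C(Icc a b, E)) :
      C(Icc a b, E) →L[ℝ] C(Icc a b, E)) = 1 - (primitive hab).comp L := by
    rw [← hu]; rfl
  rw [h3]
  exact h2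

/-- Solutions of `Y' = W (c, Y)` on a segment that contains their initial time depend smoothly on
the initial value, as elements of the space of continuous maps. -/
theorem exists_contDiffOn_integral_curves [CompleteSpace E] (hab : a ≤ b) {U : Set (P × E)}
    (hU : IsOpen U) {W : P × E → E} (hW : ContDiffOn ℝ ∞ W U) (c : C(Icc a b, P))
    {Y₀ : C(Icc a b, E)} (hY₀ : ∀ t, (c t, Y₀ t) ∈ U) {y₀ : E}
    (h₀ : picardDefect hab W c Y₀ = const _ y₀) :
    ∃ N ∈ 𝓝 y₀, ∃ Y : E → C(Icc a b, E), ContDiffOn ℝ ∞ Y N ∧ Y y₀ = Y₀ ∧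
      ∀ y ∈ N, (∀ t, (c t, Y y t) ∈ U) ∧ picardDefect hab W c (Y y) = const _ y := by
  have hO := isOpen_forall_prodMk_mem hU c
  have hΦ : ∀ Y : C(Icc a b, E), (∀ t, (c t, Y t) ∈ U) →
      ContDiffAt ℝ ∞ (picardDefect hab W c) Y := fun Y hY =>
    (contDiffOn_picardDefect hab hU hW c).contDiffAt (hO.mem_nhds hY)
  obtain ⟨e₀, he₀⟩ := exists_equiv_hasFDerivAt_picardDefect hab hU hW c hY₀
  -- The solution with initial value y is the local inverse evaluated at the constant map y.
  set R := (hΦ Y₀ hY₀).toOpenPartialHomeomorph _ he₀ (by simp)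
  have hRΦ : ∀ Y, R Y = picardDefect hab W c Y := fun _ => rfl
  have hsrc : Y₀ ∈ R.source := (hΦ Y₀ hY₀).mem_toOpenPartialHomeomorph_source he₀ (by simp)
  have htgt : const _ y₀ ∈ R.target := by
    rw [← h₀]; exact (hΦ Y₀ hY₀).image_mem_toOpenPartialHomeomorph_target he₀ (by simp)
  have hsymm : R.symm (const _ y₀) = Y₀ := by
    rw [← h₀]; exact R.left_inv hsrc
  have hopen := R.isOpen_inter_preimage_symm hO
  have hcst : ContDiff ℝ ∞ fun y : E => const (Icc a b) y :=
    (ContinuousLinearMap.const ℝ (Icc a b) : E →L[ℝ] C(Icc a b, E)).contDiff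
  refine ⟨_, (hopen.preimage hcst.continuous).mem_nhds ⟨htgt, ?_⟩,
    fun y => R.symm (const _ y), ?_, hsymm, ?_⟩
  · rw [mem_preimage, hsymm]; exact hY₀
  · rintro y ⟨hy1, hy2⟩
    -- The derivative is invertible at every admissible map, so the inverse is smooth on all of N
    -- and not only at the base point.
    obtain ⟨e, he⟩ := exists_equiv_hasFDerivAt_picardDefect hab hU hW c hy2
    exact ((R.contDiffAt_symm hy1 he (hΦ _ hy2)).comp y hcst.contDiffAt).contDiffWithinAt
  · rintro y ⟨hy1, hy2⟩
    exact ⟨hy2, R.right_inv hy1⟩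

end ParameterDependence

/-! ### Cross products, dual bases and rotations -/

section VectorAlgebra

/-- Euclidean three-space. -/
abbrev Vec3 : Type := EuclideanSpace ℝ (Fin 3)

/-- The cross product in Euclidean three-space. -/
noncomputable def cross (u v : Vec3) : Vec3 :=
  !₂[u 1 * v 2 - u 2 * v 1, u 2 * v 0 - u 0 * v 2, u 0 * v 1 - u 1 * v 0]

@[simp] theorem cross_zero (u v : Vec3) : cross u v 0 = u 1 * v 2 - u 2 * v 1 := rfl

@[simp] theorem cross_one (u v : Vec3) : cross u v 1 = u 2 * v 0 - u 0 * v 2 := rfl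

@[simp] theorem cross_two (u v : Vec3) : cross u v 2 = u 0 * v 1 - u 1 * v 0 := rfl

theorem inner_eq_sum_three (x y : Vec3) : inner ℝ x y = x 0 * y 0 + x 1 * y 1 + x 2 * y 2 := by
  simp [PiLp.inner_apply, Fin.sum_univ_three, mul_comm]

theorem mixedProduct_eq (u v w : Vec3) : mixedProduct u v w =
    (u 1 * v 2 - u 2 * v 1) * w 0 + (u 2 * v 0 - u 0 * v 2) * w 1
      + (u 0 * v 1 - u 1 * v 0) * w 2 := by
  simp [mixedProduct, Matrix.det_fin_three]
  ring

theorem inner_cross (u v w : Vec3) : inner ℝ (cross u v) w = mixedProduct u v w := by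
  rw [inner_eq_sum_three, mixedProduct_eq]; simp

theorem Vec3.ext_coords {x y : Vec3} (h0 : x 0 = y 0) (h1 : x 1 = y 1) (h2 : x 2 = y 2) :
    x = y := by
  ext i; fin_cases i <;> assumption

/-- The vector whose inner products with the basis `a, b, c` are `k 0, k 1, k 2`. -/
noncomputable def vectorOfInner (a b c : Vec3) (k : Fin 3 → ℝ) : Vec3 :=
  (mixedProduct a b c)⁻¹ • (k 0 • cross b c + k 1 • cross c a + k 2 • cross a b)

/-- The cross products b × c, c × a, a × b divided by the mixed product form the dual basis. -/
theorem mixedProduct_smul_eq (a b c x : Vec3) : mixedProduct a b c • x =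
    inner ℝ x a • cross b c + inner ℝ x b • cross c a + inner ℝ x c • cross a b := by
  apply Vec3.ext_coords <;>
  · simp [inner_eq_sum_three, mixedProduct_eq]
    ring

theorem mixedProduct_smul_eq_combination (a b c x : Vec3) : mixedProduct a b c • x =
    inner ℝ x (cross b c) • a + inner ℝ x (cross c a) • b + inner ℝ x (cross a b) • c := by
  apply Vec3.ext_coords <;>
  · simp [inner_eq_sum_three, mixedProduct_eq]
    ring

variable {a b c : Vec3}

theorem vectorOfInner_inner (h : mixedProduct a b c ≠ 0) (x : Vec3) {k : Fin 3 → ℝ}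
    (h0 : inner ℝ x a = k 0) (h1 : inner ℝ x b = k 1) (h2 : inner ℝ x c = k 2) :
    vectorOfInner a b c k = x := by
  rw [vectorOfInner, ← h0, ← h1, ← h2, ← mixedProduct_smul_eq, inv_smul_smul₀ h]

theorem inner_vectorOfInner (h : mixedProduct a b c ≠ 0) (k : Fin 3 → ℝ) :
    inner ℝ (vectorOfInner a b c k) a = k 0 ∧ inner ℝ (vectorOfInner a b c k) b = k 1 ∧
      inner ℝ (vectorOfInner a b c k) c = k 2 := by
  refine ⟨?_, ?_, ?_⟩ <;>
  · rw [vectorOfInner, inner_smul_left, RCLike.conj_to_real, inv_mul_eq_iff_eq_mul₀ h]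
    simp [inner_eq_sum_three, mixedProduct_eq]
    ring

theorem eq_of_inner_eq (h : mixedProduct a b c ≠ 0) {x y : Vec3} (h0 : inner ℝ x a = inner ℝ y a)
    (h1 : inner ℝ x b = inner ℝ y b) (h2 : inner ℝ x c = inner ℝ y c) : x = y :=
  (vectorOfInner_inner h x (k := ![_, _, _]) h0 h1 h2).symm.trans
    (vectorOfInner_inner h y rfl rfl rfl)

/-- The mixed product here is |a × b|², which vanishes only if a × b does. -/
theorem mixedProduct_cross_right_ne_zero (h : mixedProduct a b c ≠ 0) :
    mixedProduct a b (cross a b) ≠ 0 := by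
  rw [← inner_cross] at h ⊢
  intro h0
  rw [inner_self_eq_zero] at h0
  simp [h0] at h

theorem mixedProduct_cross_right_ne_zero' (h : mixedProduct a b c ≠ 0) :
    mixedProduct a c (cross a c) ≠ 0 := by
  apply mixedProduct_cross_right_ne_zero (c := b)
  contrapose! h
  rw [mixedProduct_eq] at h ⊢
  linarith

/-- The right side is the Gram determinant. -/
theorem mixedProduct_sq (a b c : Vec3) : mixedProduct a b c ^ 2 =
    inner ℝ a a * (inner ℝ b b * inner ℝ c c - inner ℝ b c ^ 2)
      - inner ℝ a b * (inner ℝ a b * inner ℝ c c - inner ℝ b c * inner ℝ a c)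
      + inner ℝ a c * (inner ℝ a b * inner ℝ b c - inner ℝ b b * inner ℝ a c) := by
  simp only [inner_eq_sum_three, mixedProduct_eq]
  ring

theorem mixedProduct_cross_right (a b : Vec3) : mixedProduct a b (cross a b) =
    inner ℝ a a * inner ℝ b b - inner ℝ a b ^ 2 := by
  simp only [inner_eq_sum_three, mixedProduct_eq, cross_zero, cross_one, cross_two]
  ring

theorem mixedProduct_map (R : Vec3 ≃ₗᵢ[ℝ] Vec3) (u v w : Vec3) :
    mixedProduct (R u) (R v) (R w) =
      LinearMap.det (R.toLinearEquiv : Vec3 →ₗ[ℝ] Vec3) * mixedProduct u v w := by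
  have h : ∀ u v w : Vec3, mixedProduct u v w =
      (EuclideanSpace.basisFun (Fin 3) ℝ).toBasis.det ![u, v, w] := by
    intro u v w
    rw [mixedProduct, Module.Basis.det_apply, ← Matrix.det_transpose]
    congr 1
  rw [h, h, ← Module.Basis.det_comp]
  congr 1
  ext i : 1
  fin_cases i <;> rfl

/-- Two triples of linearly independent vectors with the same Gram matrix and the same orientation
differ by a rotation. -/
theorem exists_rotation {Y Z : Fin 3 → Vec3} (hg : ∀ i j, inner ℝ (Y i) (Y j) = inner ℝ (Z i) (Z j))
    (hD : 0 < mixedProduct (Y 0) (Y 1) (Y 2) * mixedProduct (Z 0) (Z 1) (Z 2)) :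
    ∃ R : Vec3 ≃ₗᵢ[ℝ] Vec3, (∀ i, R (Y i) = Z i) ∧
      ∀ u v w, mixedProduct (R u) (R v) (R w) = mixedProduct u v w := by
  have hY : mixedProduct (Y 0) (Y 1) (Y 2) ≠ 0 := fun h => by simp [h] at hD
  have hZ : mixedProduct (Z 0) (Z 1) (Z 2) ≠ 0 := fun h => by simp [h] at hD
  have hYZ : mixedProduct (Y 0) (Y 1) (Y 2) = mixedProduct (Z 0) (Z 1) (Z 2) := by
    have h2 : mixedProduct (Y 0) (Y 1) (Y 2) ^ 2 = mixedProduct (Z 0) (Z 1) (Z 2) ^ 2 := by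
      simp only [mixedProduct_sq, hg]
    rcases sq_eq_sq_iff_eq_or_eq_neg.1 h2 with h | h
    · exact h
    · rw [h] at hD
      nlinarith [sq_nonneg (mixedProduct (Z 0) (Z 1) (Z 2))]
  -- The map is prescribed by its inner products with the `Z i`; linearity then follows from
  -- uniqueness.
  let r : Vec3 → Vec3 := fun x => vectorOfInner (Z 0) (Z 1) (Z 2) fun i => inner ℝ x (Y i)
  have hr : ∀ x i, inner ℝ (r x) (Z i) = inner ℝ x (Y i) := by
    intro x i
    obtain ⟨h0, h1, h2⟩ := inner_vectorOfInner hZ fun i => inner ℝ x (Y i)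
    fin_cases i <;> assumption
  have heq : ∀ x y : Vec3, (∀ i, inner ℝ x (Z i) = inner ℝ y (Z i)) → x = y :=
    fun x y h => eq_of_inner_eq hZ (h 0) (h 1) (h 2)
  let l : Vec3 →ₗ[ℝ] Vec3 :=
    { toFun := r
      map_add' := fun x y => heq _ _ fun i => by simp only [hr, inner_add_left]
      map_smul' := fun s x => heq _ _ fun i => by
        simp only [hr, inner_smul_left, RingHom.id_apply] }
  have hlr : ∀ x, l x = r x := fun _ => rfl
  have hlY : ∀ i, l (Y i) = Z i := fun i => heq _ _ fun j => by rw [hlr, hr, hg]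
  have hiso : ∀ x, ‖l x‖ = ‖x‖ := by
    intro x
    -- Expand x in the basis `Y i`, apply l, and pair with l x: the coefficients are unchanged and
    -- the products with `Z i` equal those of x with `Y i`.
    have hx := mixedProduct_smul_eq_combination (Y 0) (Y 1) (Y 2) x
    have hlx := congrArg l hx
    simp only [map_add, map_smul, hlY] at hlx
    have h1 := congrArg (fun z => inner ℝ (l x) z) hlx
    have h2 := congrArg (fun z => inner ℝ x z) hx
    simp only [inner_add_right, inner_smul_right, hlr, hr] at h1 h2
    have h3 : inner ℝ (l x) (l x) = inner ℝ x x := mul_left_cancel₀ hY (h1.trans h2.symm)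
    rw [real_inner_self_eq_norm_sq, real_inner_self_eq_norm_sq] at h3
    exact (sq_eq_sq₀ (norm_nonneg _) (norm_nonneg _)).1 h3
  refine ⟨LinearIsometry.toLinearIsometryEquiv ⟨l, hiso⟩ rfl, hlY, ?_⟩
  set R : Vec3 ≃ₗᵢ[ℝ] Vec3 := LinearIsometry.toLinearIsometryEquiv ⟨l, hiso⟩ rfl
  have hRY : ∀ i, R (Y i) = Z i := hlY
  have hdet := mixedProduct_map R (Y 0) (Y 1) (Y 2)
  rw [hRY, hRY, hRY, ← hYZ] at hdet
  have h1 : LinearMap.det (R.toLinearEquiv : Vec3 →ₗ[ℝ] Vec3) = 1 :=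
    mul_right_cancel₀ hY (by rw [one_mul]; exact hdet.symm)
  intro u v w
  rw [mixedProduct_map, h1, one_mul]

theorem cross_map {R : Vec3 ≃ₗᵢ[ℝ] Vec3}
    (hR : ∀ u v w, mixedProduct (R u) (R v) (R w) = mixedProduct u v w) (u v : Vec3) :
    cross (R u) (R v) = R (cross u v) := by
  refine ext_inner_right ℝ fun w => ?_
  obtain ⟨z, rfl⟩ := R.surjective w
  rw [inner_cross, hR, R.inner_map_map, inner_cross]

@[fun_prop]
theorem ContDiff.cross {X : Type} [NormedAddCommGroup X] [NormedSpace ℝ X] {n : WithTop ℕ∞}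
    {f g : X → Vec3} (hf : ContDiff ℝ n f) (hg : ContDiff ℝ n g) :
    ContDiff ℝ n fun x => cross (f x) (g x) := by
  have hf' := contDiff_euclidean.1 hf
  have hg' := contDiff_euclidean.1 hg
  refine contDiff_euclidean.2 fun i => ?_
  fin_cases i
  · exact ((hf' 1).mul (hg' 2)).sub ((hf' 2).mul (hg' 1))
  · exact ((hf' 2).mul (hg' 0)).sub ((hf' 0).mul (hg' 2))
  · exact ((hf' 0).mul (hg' 1)).sub ((hf' 1).mul (hg' 0))

@[fun_prop]
theorem ContDiff.mixedProduct {X : Type} [NormedAddCommGroup X] [NormedSpace ℝ X]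
    {n : WithTop ℕ∞} {f g h : X → Vec3} (hf : ContDiff ℝ n f) (hg : ContDiff ℝ n g)
    (hh : ContDiff ℝ n h) : ContDiff ℝ n fun x => mixedProduct (f x) (g x) (h x) := by
  simp_rw [← inner_cross]
  exact (hf.cross hg).inner ℝ hh

theorem contDiffOn_vectorOfInner {X : Type} [NormedAddCommGroup X] [NormedSpace ℝ X]
    {n : WithTop ℕ∞} {f g h : X → Vec3} {k : X → Fin 3 → ℝ} {s : Set X} (hf : ContDiff ℝ n f)
    (hg : ContDiff ℝ n g) (hh : ContDiff ℝ n h) (hk : ContDiff ℝ n k)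
    (hs : ∀ x ∈ s, mixedProduct (f x) (g x) (h x) ≠ 0) :
    ContDiffOn ℝ n (fun x => vectorOfInner (f x) (g x) (h x) (k x)) s := by
  have hk' := contDiff_pi.1 hk
  refine ContDiffOn.smul ((hf.mixedProduct hg hh).contDiffOn.inv hs) (ContDiff.contDiffOn ?_)
  exact (((hk' 0).smul (hg.cross hh)).add ((hk' 1).smul (hh.cross hf))).add
    ((hk' 2).smul (hf.cross hg))

end VectorAlgebra

/-! ### The differential equation of the moving basis -/

section RibbonField

/-- The inner products that determine the velocity `Y'` of a moving basis `Y` of a ribbon surface: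
here `Y = (ḟ₁, Δf₀, Δf₁)`. -/
noncomputable def ribbonCoeff (Y Y' : Fin 3 → Vec3) : Fin 3 → Fin 3 → ℝ :=
  ![![inner ℝ (Y' 0) (Y 0), inner ℝ (Y' 0) (Y 1), inner ℝ (Y' 0) (Y 2)],
    ![inner ℝ (Y' 1) (Y 0), inner ℝ (Y' 1) (Y 1), inner ℝ (Y' 1) (cross (Y 0) (Y 1))],
    ![inner ℝ (Y' 2) (Y 0), inner ℝ (Y' 2) (Y 2), inner ℝ (Y' 2) (cross (Y 0) (Y 2))]]

/-- The velocity of the moving basis `x.2` with the inner products `x.1`. -/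
noncomputable def ribbonField (x : (Fin 3 → Fin 3 → ℝ) × (Fin 3 → Vec3)) : Fin 3 → Vec3 :=
  ![vectorOfInner (x.2 0) (x.2 1) (x.2 2) (x.1 0),
    vectorOfInner (x.2 0) (x.2 1) (cross (x.2 0) (x.2 1)) (x.1 1),
    vectorOfInner (x.2 0) (x.2 2) (cross (x.2 0) (x.2 2)) (x.1 2)]

/-- The domain of `ribbonField`: the vectors of `x.2` form a basis. -/
def ribbonDomain : Set ((Fin 3 → Fin 3 → ℝ) × (Fin 3 → Vec3)) :=
  {x | mixedProduct (x.2 0) (x.2 1) (x.2 2) ≠ 0}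

theorem isOpen_ribbonDomain : IsOpen ribbonDomain := by
  have h : ContDiff ℝ ∞ fun x : (Fin 3 → Fin 3 → ℝ) × (Fin 3 → Vec3) =>
    mixedProduct (x.2 0) (x.2 1) (x.2 2) := by fun_prop
  exact isOpen_ne_fun h.continuous continuous_const

theorem contDiffOn_ribbonField : ContDiffOn ℝ ∞ ribbonField ribbonDomain := by
  refine contDiffOn_pi.2 fun i => ?_
  fin_cases i
  · exact contDiffOn_vectorOfInner (by fun_prop) (by fun_prop) (by fun_prop) (by fun_prop)
      fun x hx => hx
  · exact contDiffOn_vectorOfInner (by fun_prop) (by fun_prop) (by fun_prop) (by fun_prop)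
      fun x hx => mixedProduct_cross_right_ne_zero hx
  · exact contDiffOn_vectorOfInner (by fun_prop) (by fun_prop) (by fun_prop) (by fun_prop)
      fun x hx => mixedProduct_cross_right_ne_zero' hx

variable {Y Y' : Fin 3 → Vec3}

theorem ribbonField_ribbonCoeff (hY : mixedProduct (Y 0) (Y 1) (Y 2) ≠ 0) (Y' : Fin 3 → Vec3) :
    ribbonField (ribbonCoeff Y Y', Y) = Y' := by
  funext i
  fin_cases i
  · exact vectorOfInner_inner hY _ rfl rfl rfl
  · exact vectorOfInner_inner (mixedProduct_cross_right_ne_zero hY) _ rfl rfl rfl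
  · exact vectorOfInner_inner (mixedProduct_cross_right_ne_zero' hY) _ rfl rfl rfl

theorem ribbonCoeff_ribbonField (hY : mixedProduct (Y 0) (Y 1) (Y 2) ≠ 0)
    (k : Fin 3 → Fin 3 → ℝ) : ribbonCoeff Y (ribbonField (k, Y)) = k := by
  obtain ⟨h00, h01, h02⟩ := inner_vectorOfInner hY (k 0)
  obtain ⟨h10, h11, h12⟩ := inner_vectorOfInner (mixedProduct_cross_right_ne_zero hY) (k 1)
  obtain ⟨h20, h21, h22⟩ := inner_vectorOfInner (mixedProduct_cross_right_ne_zero' hY) (k 2)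
  funext i j
  fin_cases i <;> fin_cases j <;> assumption

theorem ribbonCoeff_map {R : Vec3 ≃ₗᵢ[ℝ] Vec3}
    (hR : ∀ u v w, mixedProduct (R u) (R v) (R w) = mixedProduct u v w) (Y Y' : Fin 3 → Vec3) :
    ribbonCoeff (fun i => R (Y i)) (fun i => R (Y' i)) = ribbonCoeff Y Y' := by
  simp [ribbonCoeff, cross_map hR]

theorem ContinuousOn.cross {X : Type} [TopologicalSpace X] {u v : X → Vec3}
    {S : Set X} (hu : ContinuousOn u S) (hv : ContinuousOn v S) :
    ContinuousOn (fun x => cross (u x) (v x)) S := by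
  have h : Continuous fun x : Vec3 × Vec3 => _root_.cross x.1 x.2 :=
    (ContDiff.cross (n := 0) contDiff_fst contDiff_snd).continuous
  exact h.comp_continuousOn (hu.prodMk hv)

theorem ContinuousOn.ribbonCoeff {X : Type} [TopologicalSpace X] {Y Y' : X → Fin 3 → Vec3}
    {S : Set X} (hY : ContinuousOn Y S) (hY' : ContinuousOn Y' S) :
    ContinuousOn (fun x => ribbonCoeff (Y x) (Y' x)) S := by
  rw [continuousOn_pi] at hY hY'
  refine continuousOn_pi.2 fun i => continuousOn_pi.2 fun j => ?_
  fin_cases i <;> fin_cases j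
  · exact (hY' 0).inner (hY 0)
  · exact (hY' 0).inner (hY 1)
  · exact (hY' 0).inner (hY 2)
  · exact (hY' 1).inner (hY 0)
  · exact (hY' 1).inner (hY 1)
  · exact (hY' 1).inner ((hY 0).cross (hY 1))
  · exact (hY' 2).inner (hY 0)
  · exact (hY' 2).inner (hY 2)
  · exact (hY' 2).inner ((hY 0).cross (hY 2))

end RibbonField

/-! ### Components of continuous maps and primitives -/

section ContinuousMapsToProducts

variable {K X F ι : Type} [TopologicalSpace K] [NormedAddCommGroup F] [NormedSpace ℝ F]
  [NormedAddCommGroup X] [NormedSpace ℝ X]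

/-- The `i`-th component of a continuous map to a finite power. -/
noncomputable def component (i : ι) : C(K, ι → F) →L[ℝ] C(K, F) :=
  (ContinuousLinearMap.proj (R := ℝ) (φ := fun _ : ι => F) i).compLeftContinuous ℝ K

@[simp]
theorem component_apply (i : ι) (g : C(K, ι → F)) (t : K) : component i g t = g t i := rfl

theorem contDiffOn_of_component [CompactSpace K] [Fintype ι] [DecidableEq ι]
    {n : WithTop ℕ∞} {g : X → C(K, ι → F)} {S : Set X}
    (h : ∀ i, ContDiffOn ℝ n (fun x => component i (g x)) S) : ContDiffOn ℝ n g S := by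
  have hg : g = fun x => ∑ i, (ContinuousLinearMap.single ℝ (fun _ : ι => F) i).compLeftContinuous
      ℝ K (component i (g x)) := by
    funext x
    ext t j
    rw [ContinuousMap.sum_apply, Finset.sum_apply]
    change _ = ∑ c, (Pi.single c (g x t c) : ι → F) j
    simp [Pi.single_apply]
  rw [hg]
  exact ContDiffOn.sum fun i _ => (ContinuousLinearMap.contDiff _).comp_contDiffOn (h i)

end ContinuousMapsToProducts

theorem eq_add_primitive {a b : ℝ} {E : Type} [NormedAddCommGroup E] [NormedSpace ℝ E]
    [CompleteSpace E] (hab : a ≤ b) {F : ℝ → E} {V : C(Icc a b, E)}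
    (h : ∀ t (ht : t ∈ Icc a b), HasDerivWithinAt F (V ⟨t, ht⟩) (Icc a b) t) {t : ℝ}
    (ht : t ∈ Icc a b) : F t = F a + primitive hab V ⟨t, ht⟩ := by
  have hc : Continuous (IccExtend hab V) := V.continuous.Icc_extend'
  have hsub : Icc a t ⊆ Icc a b := Icc_subset_Icc_right ht.2
  rw [primitive_apply, intervalIntegral.integral_eq_sub_of_hasDeriv_right_of_le ht.1 (f := F)
    (fun x hx => (h x (hsub hx)).continuousWithinAt.mono hsub) ?_ (hc.intervalIntegrable _ _)]
  · simp
  · intro x hx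
    have hx' : x ∈ Icc a b := hsub (Ioo_subset_Icc_self hx)
    rw [IccExtend_of_mem _ _ hx']
    exact (h x hx').mono_of_mem_nhdsWithin
      (mem_nhdsWithin_of_mem_nhds (Icc_mem_nhds hx.1 (hx.2.trans_le ht.2)))

/-! ### The moving basis of a surface and smoothness of families -/

namespace TwoRibbonSurface

variable {a b : ℝ}

/-- The acceleration of the middle curve. -/
noncomputable def acc (f : TwoRibbonSurface a b) (t : ℝ) : Vec3 :=
  derivWithin (f.vel 1) (Icc a b) t

/-- The moving basis `(ḟ₁, Δf₀, Δf₁)`. -/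
noncomputable def frame (f : TwoRibbonSurface a b) (t : ℝ) : Fin 3 → Vec3 :=
  ![f.vel 1 t, f.diff 0 t, f.diff 1 t]

/-- The velocity of the moving basis. -/
noncomputable def frameVel (f : TwoRibbonSurface a b) (t : ℝ) : Fin 3 → Vec3 :=
  ![f.acc t, f.vel 1 t - f.vel 0 t, f.vel 2 t - f.vel 1 t]

variable (f : TwoRibbonSurface a b)

theorem hasDerivWithinAt_curve (i : Fin 3) {t : ℝ} (ht : t ∈ Icc a b) :
    HasDerivWithinAt (f.curve i) (f.vel i t) (Icc a b) t :=
  (((f.contDiffOn i).differentiableOn (by fin_cases i <;> simp [ribbonOrder])) t ht).hasDerivWithinAt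

theorem contDiffOn_vel_one : ContDiffOn ℝ 1 (f.vel 1) (Icc a b) :=
  (f.contDiffOn 1).derivWithin (uniqueDiffOn_Icc f.lt) (by simp [ribbonOrder]; norm_num)

theorem continuousOn_vel (i : Fin 3) : ContinuousOn (f.vel i) (Icc a b) :=
  (f.contDiffOn i).continuousOn_derivWithin (uniqueDiffOn_Icc f.lt)
    (by fin_cases i <;> simp [ribbonOrder])

theorem continuousOn_acc : ContinuousOn f.acc (Icc a b) :=
  f.contDiffOn_vel_one.continuousOn_derivWithin (uniqueDiffOn_Icc f.lt) le_rfl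

theorem hasDerivWithinAt_frame {t : ℝ} (ht : t ∈ Icc a b) :
    HasDerivWithinAt f.frame (f.frameVel t) (Icc a b) t := by
  refine hasDerivWithinAt_pi.2 fun i => ?_
  fin_cases i
  · exact (f.contDiffOn_vel_one.differentiableOn one_ne_zero t ht).hasDerivWithinAt
  · exact (f.hasDerivWithinAt_curve 1 ht).sub (f.hasDerivWithinAt_curve 0 ht)
  · exact (f.hasDerivWithinAt_curve 2 ht).sub (f.hasDerivWithinAt_curve 1 ht)

theorem continuousOn_frame : ContinuousOn f.frame (Icc a b) :=
  fun _ ht => (f.hasDerivWithinAt_frame ht).continuousWithinAt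

theorem continuousOn_frameVel : ContinuousOn f.frameVel (Icc a b) := by
  refine continuousOn_pi.2 fun i => ?_
  fin_cases i
  · exact f.continuousOn_acc
  · exact (f.continuousOn_vel 1).sub (f.continuousOn_vel 0)
  · exact (f.continuousOn_vel 2).sub (f.continuousOn_vel 1)

/-- The moving basis as a continuous map. -/
noncomputable def frameMap : C(Icc a b, Fin 3 → Vec3) :=
  ⟨fun t => f.frame t, continuousOn_iff_continuous_domRestrict.mp f.continuousOn_frame⟩

/-- The velocity of the moving basis as a continuous map. -/
noncomputable def frameVelMap : C(Icc a b, Fin 3 → Vec3) :=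
  ⟨fun t => f.frameVel t, continuousOn_iff_continuous_domRestrict.mp f.continuousOn_frameVel⟩

@[simp] theorem frameMap_apply (t : Icc a b) : f.frameMap t = f.frame t := rfl

@[simp] theorem frameVelMap_apply (t : Icc a b) : f.frameVelMap t = f.frameVel t := rfl

theorem jet_of_val_eq_zero {i : Fin 3} {j : Fin (ribbonOrder i + 1)} (hj : (j : ℕ) = 0)
    (t : Icc a b) : f.jet i j t = f.curve i t := by
  simp [jet, hj]

theorem jet_of_val_eq_one {i : Fin 3} {j : Fin (ribbonOrder i + 1)} (hj : (j : ℕ) = 1)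
    (t : Icc a b) : f.jet i j t = f.vel i t := by
  simp [jet, hj, iteratedDerivWithin_one, vel]

theorem jet_of_val_eq_two {j : Fin (ribbonOrder 1 + 1)} (hj : (j : ℕ) = 2) (t : Icc a b) :
    f.jet 1 j t = f.acc t := by
  simp only [jet, ContinuousMap.coe_mk, hj]
  rw [iteratedDerivWithin_succ]
  refine derivWithin_congr (fun x _ => ?_) ?_ <;> simp [iteratedDerivWithin_one, vel]

theorem curve_one_eq_add_primitive {t : ℝ} (ht : t ∈ Icc a b) :
    f.curve 1 t = f.curve 1 a + primitive f.lt.le (component 0 f.frameMap) ⟨t, ht⟩ :=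
  eq_add_primitive _ (fun _ hx => f.hasDerivWithinAt_curve 1 hx) ht

theorem frameMap_eq_add_primitive :
    f.frameMap = ContinuousMap.const _ (f.frame a) + primitive f.lt.le f.frameVelMap := by
  ext t : 1
  exact eq_add_primitive _ (V := f.frameVelMap) (fun _ hx => f.hasDerivWithinAt_frame hx) t.2

variable {γ : ℝ → TwoRibbonSurface a b} {S : Set ℝ} {k : WithTop ℕ∞}

theorem IsCurveOfClass.contDiffOn_frameMap (h : IsCurveOfClass k γ S) :
    ContDiffOn ℝ k (fun s => (γ s).frameMap) S := by
  refine contDiffOn_of_component fun i => ?_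
  fin_cases i
  · refine (h 1 1).congr fun s _ => ?_
    ext t : 1
    exact ((γ s).jet_of_val_eq_one rfl t).symm
  · refine ((h 1 0).sub (h 0 0)).congr fun s _ => ?_
    ext t : 1
    rw [ContinuousMap.sub_apply, jet_of_val_eq_zero _ rfl, jet_of_val_eq_zero _ rfl]
    rfl
  · refine ((h 2 0).sub (h 1 0)).congr fun s _ => ?_
    ext t : 1
    rw [ContinuousMap.sub_apply, jet_of_val_eq_zero _ rfl, jet_of_val_eq_zero _ rfl]
    rfl

theorem IsCurveOfClass.contDiffOn_frameVelMap (h : IsCurveOfClass k γ S) :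
    ContDiffOn ℝ k (fun s => (γ s).frameVelMap) S := by
  refine contDiffOn_of_component fun i => ?_
  fin_cases i
  · refine (h 1 2).congr fun s _ => ?_
    ext t : 1
    exact ((γ s).jet_of_val_eq_two rfl t).symm
  · refine ((h 1 1).sub (h 0 1)).congr fun s _ => ?_
    ext t : 1
    rw [ContinuousMap.sub_apply, jet_of_val_eq_one _ rfl, jet_of_val_eq_one _ rfl]
    rfl
  · refine ((h 2 1).sub (h 1 1)).congr fun s _ => ?_
    ext t : 1
    rw [ContinuousMap.sub_apply, jet_of_val_eq_one _ rfl, jet_of_val_eq_one _ rfl]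
    rfl

/-- All jets depend linearly and continuously on the given data: f₁ is a primitive of Y₀, f₀ = f₁ -
Y₁, f₂ = f₁ + Y₂, ḟ₀ = Y₀ - Y₁', ḟ₂ = Y₀ + Y₂', f̈₁ = Y₀'. -/
theorem isCurveOfClass_of_frameMap (h₀ : ContDiffOn ℝ k (fun s => (γ s).curve 1 a) S)
    (h : ContDiffOn ℝ k (fun s => (γ s).frameMap) S)
    (h' : ContDiffOn ℝ k (fun s => (γ s).frameVelMap) S) : IsCurveOfClass k γ S := by
  have hY : ∀ i, ContDiffOn ℝ k (fun s => component i (γ s).frameMap) S := fun i =>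
    (ContinuousLinearMap.contDiff _).comp_contDiffOn h
  have hV : ∀ i, ContDiffOn ℝ k (fun s => component i (γ s).frameVelMap) S := fun i =>
    (ContinuousLinearMap.contDiff _).comp_contDiffOn h'
  have hjet : ∀ i (j : Fin (ribbonOrder i + 1)) (g : ℝ → C(Icc a b, Vec3)), ContDiffOn ℝ k g S →
      (∀ s t, (γ s).jet i j t = g s t) → ContDiffOn ℝ k (fun s => (γ s).jet i j) S :=
    fun i j g hg he => hg.congr fun s _ => ContinuousMap.ext (he s)
  have hlt := (γ 0).lt.le
  have h1 : ContDiffOn ℝ k (fun s => ContinuousMap.const (Icc a b) ((γ s).curve 1 a)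
      + primitive hlt (component 0 (γ s).frameMap)) S :=
    ((ContinuousLinearMap.const ℝ (Icc a b) : Vec3 →L[ℝ] C(Icc a b, Vec3)).contDiff.comp_contDiffOn
      h₀).add ((ContinuousLinearMap.contDiff _).comp_contDiffOn (hY 0))
  have hc1 : ∀ s (t : Icc a b), (γ s).curve 1 t = (ContinuousMap.const (Icc a b) ((γ s).curve 1 a)
      + primitive hlt (component 0 (γ s).frameMap)) t :=
    fun s t => (γ s).curve_one_eq_add_primitive t.2
  intro i j
  fin_cases i
  · obtain ⟨j, hj⟩ := j
    obtain rfl | rfl : j = 0 ∨ j = 1 := by change j < 2 at hj; omega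
    · refine hjet _ _ _ (h1.sub (hY 1)) fun s t => ?_
      rw [jet_of_val_eq_zero _ rfl, ContinuousMap.sub_apply, ← hc1]
      simp [frame, diff]
    · refine hjet _ _ _ ((hY 0).sub (hV 1)) fun s t => ?_
      rw [jet_of_val_eq_one _ rfl]
      simp [frame, frameVel]
  · obtain ⟨j, hj⟩ := j
    obtain rfl | rfl | rfl : j = 0 ∨ j = 1 ∨ j = 2 := by change j < 3 at hj; omega
    · refine hjet _ _ _ h1 fun s t => ?_
      rw [jet_of_val_eq_zero _ rfl, ← hc1]
      rfl
    · refine hjet _ _ _ (hY 0) fun s t => ?_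
      rw [jet_of_val_eq_one _ rfl]
      simp [frame]
    · refine hjet _ _ _ (hV 0) fun s t => ?_
      exact jet_of_val_eq_two _ rfl t
  · obtain ⟨j, hj⟩ := j
    obtain rfl | rfl : j = 0 ∨ j = 1 := by change j < 2 at hj; omega
    · refine hjet _ _ _ (h1.add (hY 2)) fun s t => ?_
      rw [jet_of_val_eq_zero _ rfl, ContinuousMap.add_apply, ← hc1]
      simp [frame, diff]
    · refine hjet _ _ _ ((hY 0).add (hV 2)) fun s t => ?_
      rw [jet_of_val_eq_one _ rfl]
      simp [frame, frameVel]

end TwoRibbonSurface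

/-! ### Reconstruction of a surface from its moving basis -/

section SurfaceOfFrame

variable {a b : ℝ}

/-- The curve with velocity `V` on `[a, b]`, extended to the line, that starts at `y`. -/
noncomputable def curveOfVelocity (hab : a ≤ b) (y : Fin 3 → Vec3) (V : C(Icc a b, Fin 3 → Vec3))
    (t : ℝ) : Fin 3 → Vec3 :=
  y + ∫ τ in a..t, IccExtend hab V τ

variable (hab : a < b) (x₀ : Vec3) (y : Fin 3 → Vec3) (V : C(Icc a b, Fin 3 → Vec3))

theorem hasDerivAt_curveOfVelocity (hab : a ≤ b) (t : ℝ) :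
    HasDerivAt (curveOfVelocity hab y V) (IccExtend hab V t) t :=
  (hasDerivAt_integral_IccExtend hab V t).const_add y

theorem contDiff_curveOfVelocity (hab : a ≤ b) : ContDiff ℝ 1 (curveOfVelocity hab y V) := by
  rw [contDiff_one_iff_deriv]
  refine ⟨fun t => (hasDerivAt_curveOfVelocity y V hab t).differentiableAt, ?_⟩
  rw [funext fun t => (hasDerivAt_curveOfVelocity y V hab t).deriv]
  exact V.continuous.Icc_extend'

/-- The curve with velocity `curveOfVelocity hab y V t 0` that starts at `x₀`. -/
noncomputable def middleCurve (hab : a ≤ b) (t : ℝ) : Vec3 :=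
  x₀ + ∫ τ in a..t, curveOfVelocity hab y V τ 0

theorem hasDerivAt_middleCurve (hab : a ≤ b) (t : ℝ) :
    HasDerivAt (middleCurve x₀ y V hab) (curveOfVelocity hab y V t 0) t := by
  have hc : Continuous fun t => curveOfVelocity hab y V t 0 :=
    (continuous_apply 0).comp (contDiff_curveOfVelocity y V hab).continuous
  exact (intervalIntegral.integral_hasDerivAt_right (hc.intervalIntegrable _ _)
    hc.stronglyMeasurable.stronglyMeasurableAtFilter hc.continuousAt).const_add x₀

theorem contDiff_middleCurve (hab : a ≤ b) : ContDiff ℝ 2 (middleCurve x₀ y V hab) := by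
  rw [show (2 : WithTop ℕ∞) = 1 + 1 by norm_num, contDiff_succ_iff_deriv]
  refine ⟨fun t => (hasDerivAt_middleCurve x₀ y V hab t).differentiableAt, by simp, ?_⟩
  rw [funext fun t => (hasDerivAt_middleCurve x₀ y V hab t).deriv]
  exact contDiff_pi.1 (contDiff_curveOfVelocity y V hab) 0

/-- The 2-ribbon surface whose moving basis has the velocity `V` and the initial value `y`, and
whose middle curve starts at `x₀`. -/
noncomputable def surfaceOfFrame : TwoRibbonSurface a b where
  lt := hab
  curve := ![fun t => middleCurve x₀ y V hab.le t - curveOfVelocity hab.le y V t 1,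
    middleCurve x₀ y V hab.le,
    fun t => middleCurve x₀ y V hab.le t + curveOfVelocity hab.le y V t 2]
  contDiffOn := by
    have h := contDiff_pi.1 (contDiff_curveOfVelocity y V hab.le)
    have hm := contDiff_middleCurve x₀ y V hab.le
    intro i
    apply ContDiff.contDiffOn
    fin_cases i
    · exact (hm.of_le (by simp [ribbonOrder])).sub (h 1)
    · exact hm
    · exact (hm.of_le (by simp [ribbonOrder])).add (h 2)

theorem surfaceOfFrame_curve_one_left : (surfaceOfFrame hab x₀ y V).curve 1 a = x₀ := by
  simp [surfaceOfFrame, middleCurve]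

theorem surfaceOfFrame_vel {t : ℝ} (ht : t ∈ Icc a b) :
    (surfaceOfFrame hab x₀ y V).vel 0 t = curveOfVelocity hab.le y V t 0 - V ⟨t, ht⟩ 1 ∧
    (surfaceOfFrame hab x₀ y V).vel 1 t = curveOfVelocity hab.le y V t 0 ∧
    (surfaceOfFrame hab x₀ y V).vel 2 t = curveOfVelocity hab.le y V t 0 + V ⟨t, ht⟩ 2 := by
  have hu := uniqueDiffOn_Icc hab t ht
  have h := hasDerivAt_pi.1 (hasDerivAt_curveOfVelocity y V hab.le t)
  have hm := hasDerivAt_middleCurve x₀ y V hab.le t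
  rw [IccExtend_of_mem _ _ ht] at h
  exact ⟨(hm.sub (h 1)).hasDerivWithinAt.derivWithin hu, hm.hasDerivWithinAt.derivWithin hu,
    (hm.add (h 2)).hasDerivWithinAt.derivWithin hu⟩

theorem surfaceOfFrame_frame {t : ℝ} (ht : t ∈ Icc a b) :
    (surfaceOfFrame hab x₀ y V).frame t = curveOfVelocity hab.le y V t := by
  funext i
  fin_cases i
  · exact (surfaceOfFrame_vel hab x₀ y V ht).2.1
  · exact sub_sub_cancel _ _
  · exact add_sub_cancel_left _ _

theorem surfaceOfFrame_frameVel {t : ℝ} (ht : t ∈ Icc a b) :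
    (surfaceOfFrame hab x₀ y V).frameVel t = V ⟨t, ht⟩ := by
  obtain ⟨h0, h1, h2⟩ := surfaceOfFrame_vel hab x₀ y V ht
  funext i
  fin_cases i
  · have h := hasDerivAt_pi.1 (hasDerivAt_curveOfVelocity y V hab.le t)
    rw [IccExtend_of_mem _ _ ht] at h
    refine ((h 0).hasDerivWithinAt.congr (fun x hx => ?_) ?_).derivWithin
      (uniqueDiffOn_Icc hab t ht)
    · exact (surfaceOfFrame_vel hab x₀ y V hx).2.1
    · exact h1
  · change TwoRibbonSurface.vel _ 1 t - TwoRibbonSurface.vel _ 0 t = _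
    rw [h0, h1, sub_sub_cancel]
    rfl
  · change TwoRibbonSurface.vel _ 2 t - TwoRibbonSurface.vel _ 1 t = _
    rw [h2, h1, add_sub_cancel_left]
    rfl

end SurfaceOfFrame

/-! ### Inner geometry in terms of the moving basis -/

/-- The quantities that determine the inner geometry agree for the moving bases `Y`, `Z` with the
velocities `Y'`, `Z'`. -/
structure FrameMetricEq (Y Y' Z Z' : Fin 3 → Vec3) : Prop where
  gram_zero_zero : inner ℝ (Z 0) (Z 0) = inner ℝ (Y 0) (Y 0)
  gram_one_one : inner ℝ (Z 1) (Z 1) = inner ℝ (Y 1) (Y 1)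
  gram_two_two : inner ℝ (Z 2) (Z 2) = inner ℝ (Y 2) (Y 2)
  gram_zero_one : inner ℝ (Z 0) (Z 1) = inner ℝ (Y 0) (Y 1)
  gram_zero_two : inner ℝ (Z 0) (Z 2) = inner ℝ (Y 0) (Y 2)
  vel_one_zero : inner ℝ (Z' 1) (Z 0) = inner ℝ (Y' 1) (Y 0)
  vel_one_one : inner ℝ (Z' 1) (Z 1) = inner ℝ (Y' 1) (Y 1)
  vel_one_self : inner ℝ (Z' 1) (Z' 1) = inner ℝ (Y' 1) (Y' 1)
  vel_two_zero : inner ℝ (Z' 2) (Z 0) = inner ℝ (Y' 2) (Y 0)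
  vel_two_two : inner ℝ (Z' 2) (Z 2) = inner ℝ (Y' 2) (Y 2)
  vel_two_self : inner ℝ (Z' 2) (Z' 2) = inner ℝ (Y' 2) (Y' 2)

theorem norm_eq_iff_inner_self_eq (x y : Vec3) : ‖x‖ = ‖y‖ ↔ inner ℝ x x = inner ℝ y y := by
  rw [real_inner_self_eq_norm_sq, real_inner_self_eq_norm_sq,
    sq_eq_sq₀ (norm_nonneg _) (norm_nonneg _)]

namespace TwoRibbonSurface

variable {a b : ℝ} {f g : TwoRibbonSurface a b}

/-- Since ḟ₀ = Y₀ - Y₁' and ḟ₂ = Y₀ + Y₂', the two lists of eleven products are linear combinations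
of each other. The entry ⟨Y₁, Y₂⟩ occurs in neither. -/
theorem sameInnerGeometry_iff : SameInnerGeometry f g ↔
    ∀ t ∈ Icc a b, FrameMetricEq (f.frame t) (f.frameVel t) (g.frame t) (g.frameVel t) := by
  refine forall₂_congr fun t _ => ?_
  have hall : ∀ p : Fin 3 → Prop, (∀ i, p i) ↔ p 0 ∧ p 1 ∧ p 2 := fun p =>
    ⟨fun h => ⟨h 0, h 1, h 2⟩, fun h i => by fin_cases i; exacts [h.1, h.2.1, h.2.2]⟩
  have e0 : (0 : Fin 2).castSucc = (0 : Fin 3) := rfl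
  have e1 : (0 : Fin 2).succ = (1 : Fin 3) := rfl
  have e2 : (1 : Fin 2).castSucc = (1 : Fin 3) := rfl
  have e3 : (1 : Fin 2).succ = (2 : Fin 3) := rfl
  simp only [hall, Fin.forall_fin_two, norm_eq_iff_inner_self_eq, e0, e1, e2, e3]
  constructor
  · rintro ⟨⟨h0, h1, h2⟩, ⟨h3, h4, h5, h6⟩, h7, h8, h9, h10⟩
    constructor <;> simp only [frame, frameVel, Matrix.cons_val_zero, Matrix.cons_val_one,
      Matrix.cons_val, inner_sub_left, inner_sub_right] <;>
    linarith [real_inner_comm (f.vel 0 t) (f.vel 1 t), real_inner_comm (f.vel 1 t) (f.vel 2 t),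
      real_inner_comm (g.vel 0 t) (g.vel 1 t), real_inner_comm (g.vel 1 t) (g.vel 2 t)]
  · rintro ⟨h0, h1, h2, h3, h4, h5, h6, h7, h8, h9, h10⟩
    simp only [frame, frameVel, Matrix.cons_val_zero, Matrix.cons_val_one,
      Matrix.cons_val, inner_sub_left, inner_sub_right] at h0 h1 h2 h3 h4 h5 h6 h7 h8 h9 h10
    refine ⟨⟨?_, ?_, ?_⟩, ⟨?_, ?_, ?_, ?_⟩, ?_, ?_, ?_, ?_⟩ <;>
    linarith [real_inner_comm (f.vel 0 t) (f.vel 1 t), real_inner_comm (f.vel 1 t) (f.vel 2 t),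
      real_inner_comm (g.vel 0 t) (g.vel 1 t), real_inner_comm (g.vel 1 t) (g.vel 2 t)]

theorem hasDerivWithinAt_gram (f : TwoRibbonSurface a b) (i j : Fin 3) {t : ℝ}
    (ht : t ∈ Icc a b) :
    HasDerivWithinAt (fun t => inner ℝ (f.frame t i) (f.frame t j))
      (inner ℝ (f.frame t i) (f.frameVel t j) + inner ℝ (f.frameVel t i) (f.frame t j))
      (Icc a b) t := by
  have h := hasDerivWithinAt_pi.1 (f.hasDerivWithinAt_frame ht)
  exact (h i).inner ℝ (h j)

theorem gram_deriv_eq {i j : Fin 3}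
    (h : ∀ t ∈ Icc a b, inner ℝ (g.frame t i) (g.frame t j) =
      inner ℝ (f.frame t i) (f.frame t j)) {t : ℝ} (ht : t ∈ Icc a b) :
    inner ℝ (g.frame t i) (g.frameVel t j) + inner ℝ (g.frameVel t i) (g.frame t j) =
      inner ℝ (f.frame t i) (f.frameVel t j) + inner ℝ (f.frameVel t i) (f.frame t j) :=
  (uniqueDiffOn_Icc f.lt t ht).eq_deriv _
    ((g.hasDerivWithinAt_gram i j ht).congr (fun x hx => (h x hx).symm) (h t ht).symm)
    (f.hasDerivWithinAt_gram i j ht)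

theorem gram_eq_of_deriv_eq {i j : Fin 3}
    (ha : inner ℝ (g.frame a i) (g.frame a j) = inner ℝ (f.frame a i) (f.frame a j))
    (h : ∀ t ∈ Icc a b,
      inner ℝ (g.frame t i) (g.frameVel t j) + inner ℝ (g.frameVel t i) (g.frame t j) =
      inner ℝ (f.frame t i) (f.frameVel t j) + inner ℝ (f.frameVel t i) (f.frame t j))
    (t : ℝ) (ht : t ∈ Icc a b) :
    inner ℝ (g.frame t i) (g.frame t j) = inner ℝ (f.frame t i) (f.frame t j) := by
  have hf := fun t ht => f.hasDerivWithinAt_gram i j (t := t) ht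
  have hg := fun t ht => g.hasDerivWithinAt_gram i j (t := t) ht
  refine eq_of_derivWithin_eq (fun t ht => (hg t ht).differentiableWithinAt)
    (fun t ht => (hf t ht).differentiableWithinAt) (fun t ht => ?_) ha t ht
  have ht' := Ico_subset_Icc_self ht
  have hu := uniqueDiffOn_Icc f.lt t ht'
  rw [(hg t ht').derivWithin hu, (hf t ht').derivWithin hu, h t ht']

/-- Isometric surfaces have moving bases that move with the same coefficients, up to the signs of
two of them. -/
theorem SameInnerGeometry.ribbonCoeff (h : SameInnerGeometry f g) {t : ℝ} (ht : t ∈ Icc a b)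
    (i j : Fin 3) :
    ribbonCoeff (g.frame t) (g.frameVel t) i j ^ 2 =
      ribbonCoeff (f.frame t) (f.frameVel t) i j ^ 2 ∧
    (j ≠ 2 ∨ i = 0 → ribbonCoeff (g.frame t) (g.frameVel t) i j =
      ribbonCoeff (f.frame t) (f.frameVel t) i j) := by
  rw [sameInnerGeometry_iff] at h
  -- Differentiating the preserved Gram entries yields the products of f̈₁ with the basis, since
  -- those of Y₁' and Y₂' with Y₀ are preserved.
  have d00 := gram_deriv_eq (fun t ht => (h t ht).gram_zero_zero) ht
  have d01 := gram_deriv_eq (fun t ht => (h t ht).gram_zero_one) ht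
  have d02 := gram_deriv_eq (fun t ht => (h t ht).gram_zero_two) ht
  obtain ⟨h0, h1, h2, h3, h4, h5, h6, h7, h8, h9, h10⟩ := h t ht
  rw [real_inner_comm, real_inner_comm (f.frameVel t 0)] at d00
  rw [real_inner_comm, real_inner_comm (f.frameVel t 1)] at d01
  rw [real_inner_comm, real_inner_comm (f.frameVel t 2)] at d02
  have key : ∀ {x y : ℝ}, x = y → x ^ 2 = y ^ 2 ∧ (j ≠ 2 ∨ i = 0 → x = y) :=
    fun h => ⟨by rw [h], fun _ => h⟩
  have sq : ∀ Y Y' : Fin 3 → Vec3, ∀ i : Fin 3,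
      inner ℝ (Y' i) (cross (Y 0) (Y i)) ^ 2 = mixedProduct (Y 0) (Y i) (Y' i) ^ 2 :=
    fun Y Y' i => by rw [real_inner_comm, inner_cross]
  fin_cases i <;> fin_cases j
  · refine key ?_
    change inner ℝ (g.frameVel t 0) (g.frame t 0) = inner ℝ (f.frameVel t 0) (f.frame t 0)
    linarith
  · refine key ?_
    change inner ℝ (g.frameVel t 0) (g.frame t 1) = inner ℝ (f.frameVel t 0) (f.frame t 1)
    linarith
  · refine key ?_
    change inner ℝ (g.frameVel t 0) (g.frame t 2) = inner ℝ (f.frameVel t 0) (f.frame t 2)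
    linarith
  · exact key h5
  · exact key h6
  -- The square is the Gram determinant of Y₀, Y₁, Y₁', all of whose entries are preserved.
  · refine ⟨(sq _ _ 1).trans (Eq.trans ?_ (sq _ _ 1).symm), by simp⟩
    rw [mixedProduct_sq, mixedProduct_sq, real_inner_comm (g.frameVel t 1) (g.frame t 1),
      real_inner_comm (f.frameVel t 1) (f.frame t 1),
      real_inner_comm (g.frameVel t 1) (g.frame t 0),
      real_inner_comm (f.frameVel t 1) (f.frame t 0), h0, h1, h3, h5, h6, h7]
  · exact key h8
  · exact key h9
  · refine ⟨(sq _ _ 2).trans (Eq.trans ?_ (sq _ _ 2).symm), by simp⟩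
    rw [mixedProduct_sq, mixedProduct_sq, real_inner_comm (g.frameVel t 2) (g.frame t 2),
      real_inner_comm (f.frameVel t 2) (f.frame t 2),
      real_inner_comm (g.frameVel t 2) (g.frame t 0),
      real_inner_comm (f.frameVel t 2) (f.frame t 0), h0, h2, h4, h8, h9, h10]

/-- The square of the length of a vector is determined by its inner products with two independent
vectors and their cross product. -/
theorem inner_self_eq_of_inner_eq {u v w x y z : Vec3} (h : mixedProduct u v (cross u v) ≠ 0)
    (huu : inner ℝ x x = inner ℝ u u) (hvv : inner ℝ y y = inner ℝ v v)
    (huv : inner ℝ x y = inner ℝ u v) (hwu : inner ℝ z x = inner ℝ w u)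
    (hwv : inner ℝ z y = inner ℝ w v)
    (hc : inner ℝ z (cross x y) = inner ℝ w (cross u v)) : inner ℝ z z = inner ℝ w w := by
  rw [real_inner_comm, inner_cross, real_inner_comm, inner_cross] at hc
  have h1 := mixedProduct_sq x y z
  have h2 := mixedProduct_sq u v w
  rw [real_inner_comm z y, real_inner_comm z x, huu, hvv, huv, hwu, hwv, hc] at h1
  rw [real_inner_comm w v, real_inner_comm w u] at h2
  rw [mixedProduct_cross_right] at h
  -- The Gram determinant of u, v, w is affine in ⟨w, w⟩, with leading coefficient |u × v|².
  refine mul_right_cancel₀ h ?_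
  linear_combination h2 - h1

/-- The coefficients contain the derivatives of the five relevant Gram entries, so equality at a
propagates; the lengths of Y₁' and Y₂' then follow from their three products. -/
theorem sameInnerGeometry_of_ribbonCoeff_eq
    (hf : ∀ t ∈ Icc a b, mixedProduct (f.frame t 0) (f.frame t 1) (f.frame t 2) ≠ 0)
    (hc : ∀ t ∈ Icc a b, _root_.ribbonCoeff (g.frame t) (g.frameVel t) =
      _root_.ribbonCoeff (f.frame t) (f.frameVel t))
    (h00 : inner ℝ (g.frame a 0) (g.frame a 0) = inner ℝ (f.frame a 0) (f.frame a 0))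
    (h11 : inner ℝ (g.frame a 1) (g.frame a 1) = inner ℝ (f.frame a 1) (f.frame a 1))
    (h22 : inner ℝ (g.frame a 2) (g.frame a 2) = inner ℝ (f.frame a 2) (f.frame a 2))
    (h01 : inner ℝ (g.frame a 0) (g.frame a 1) = inner ℝ (f.frame a 0) (f.frame a 1))
    (h02 : inner ℝ (g.frame a 0) (g.frame a 2) = inner ℝ (f.frame a 0) (f.frame a 2)) :
    SameInnerGeometry f g := by
  rw [sameInnerGeometry_iff]
  have c : ∀ i j, ∀ t ∈ Icc a b, _root_.ribbonCoeff (g.frame t) (g.frameVel t) i j =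
      _root_.ribbonCoeff (f.frame t) (f.frameVel t) i j := fun i j t ht => by rw [hc t ht]
  have c00 : ∀ t ∈ Icc a b, inner ℝ (g.frameVel t 0) (g.frame t 0) =
    inner ℝ (f.frameVel t 0) (f.frame t 0) := c 0 0
  have c01 : ∀ t ∈ Icc a b, inner ℝ (g.frameVel t 0) (g.frame t 1) =
    inner ℝ (f.frameVel t 0) (f.frame t 1) := c 0 1
  have c02 : ∀ t ∈ Icc a b, inner ℝ (g.frameVel t 0) (g.frame t 2) =
    inner ℝ (f.frameVel t 0) (f.frame t 2) := c 0 2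
  have c10 : ∀ t ∈ Icc a b, inner ℝ (g.frameVel t 1) (g.frame t 0) =
    inner ℝ (f.frameVel t 1) (f.frame t 0) := c 1 0
  have c11 : ∀ t ∈ Icc a b, inner ℝ (g.frameVel t 1) (g.frame t 1) =
    inner ℝ (f.frameVel t 1) (f.frame t 1) := c 1 1
  have c12 : ∀ t ∈ Icc a b, inner ℝ (g.frameVel t 1) (cross (g.frame t 0) (g.frame t 1)) =
    inner ℝ (f.frameVel t 1) (cross (f.frame t 0) (f.frame t 1)) := c 1 2
  have c20 : ∀ t ∈ Icc a b, inner ℝ (g.frameVel t 2) (g.frame t 0) =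
    inner ℝ (f.frameVel t 2) (f.frame t 0) := c 2 0
  have c22 : ∀ t ∈ Icc a b, inner ℝ (g.frameVel t 2) (g.frame t 2) =
    inner ℝ (f.frameVel t 2) (f.frame t 2) := c 2 1
  have c2c : ∀ t ∈ Icc a b, inner ℝ (g.frameVel t 2) (cross (g.frame t 0) (g.frame t 2)) =
    inner ℝ (f.frameVel t 2) (cross (f.frame t 0) (f.frame t 2)) := c 2 2
  have flip := fun x y : Vec3 => real_inner_comm x y
  have g00 := gram_eq_of_deriv_eq h00 fun t ht => by
    rw [← flip, c00 t ht, flip]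
  have g11 := gram_eq_of_deriv_eq h11 fun t ht => by
    rw [← flip, c11 t ht, flip]
  have g22 := gram_eq_of_deriv_eq h22 fun t ht => by
    rw [← flip, c22 t ht, flip]
  have g01 := gram_eq_of_deriv_eq h01 fun t ht => by
    rw [← flip, c10 t ht, c01 t ht, flip]
  have g02 := gram_eq_of_deriv_eq h02 fun t ht => by
    rw [← flip, c20 t ht, c02 t ht, flip]
  intro t ht
  exact
    { gram_zero_zero := g00 t ht
      gram_one_one := g11 t ht
      gram_two_two := g22 t ht
      gram_zero_one := g01 t ht
      gram_zero_two := g02 t ht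
      vel_one_zero := c10 t ht
      vel_one_one := c11 t ht
      vel_one_self := inner_self_eq_of_inner_eq (mixedProduct_cross_right_ne_zero (hf t ht))
        (g00 t ht) (g11 t ht) (g01 t ht) (c10 t ht) (c11 t ht) (c12 t ht)
      vel_two_zero := c20 t ht
      vel_two_two := c22 t ht
      vel_two_self := inner_self_eq_of_inner_eq (mixedProduct_cross_right_ne_zero' (hf t ht))
        (g00 t ht) (g22 t ht) (g02 t ht) (c20 t ht) (c22 t ht) (c2c t ht) }

theorem vel_congr (h : ∀ i, EqOn (g.curve i) (f.curve i) (Icc a b)) {t : ℝ} (ht : t ∈ Icc a b)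
    (i : Fin 3) : g.vel i t = f.vel i t :=
  derivWithin_congr (h i) (h i ht)

theorem frame_congr (h : ∀ i, EqOn (g.curve i) (f.curve i) (Icc a b)) {t : ℝ}
    (ht : t ∈ Icc a b) : g.frame t = f.frame t := by
  simp [frame, diff, vel_congr h ht, h _ ht]

theorem frameVel_congr (h : ∀ i, EqOn (g.curve i) (f.curve i) (Icc a b)) {t : ℝ}
    (ht : t ∈ Icc a b) : g.frameVel t = f.frameVel t := by
  have : g.acc t = f.acc t :=
    derivWithin_congr (fun x hx => vel_congr h hx 1) (vel_congr h ht 1)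
  simp [frameVel, vel_congr h ht, this]

theorem continuousOn_frame_param {k : WithTop ℕ∞} {S : Set ℝ} {γ : ℝ → TwoRibbonSurface a b}
    (hγ : IsCurveOfClass k γ S) {t : ℝ} (ht : t ∈ Icc a b) :
    ContinuousOn (fun s => (γ s).frame t) S ∧ ContinuousOn (fun s => (γ s).frameVel t) S := by
  have hev : Continuous fun Y : C(Icc a b, Fin 3 → Vec3) => Y ⟨t, ht⟩ :=
    continuous_eval_const (⟨t, ht⟩ : Icc a b)
  exact ⟨hev.comp_continuousOn hγ.contDiffOn_frameMap.continuousOn,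
    hev.comp_continuousOn hγ.contDiffOn_frameVelMap.continuousOn⟩

/-- Along a continuous flexion the coefficients of the motion of the moving basis do not change. -/
theorem IsFlexion.ribbonCoeff_eq {k : WithTop ℕ∞} {S : Set ℝ} {γ : ℝ → TwoRibbonSurface a b}
    (hγ : f.IsFlexion k S γ) (hS : IsPreconnected S) (h0 : 0 ∈ S) {s : ℝ} (hs : s ∈ S) {t : ℝ}
    (ht : t ∈ Icc a b) : ribbonCoeff ((γ s).frame t) ((γ s).frameVel t) =
      ribbonCoeff (f.frame t) (f.frameVel t) := by
  funext i j
  obtain ⟨hY, hV⟩ := continuousOn_frame_param hγ.smooth ht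
  have hc : ContinuousOn (fun s => ribbonCoeff ((γ s).frame t) ((γ s).frameVel t)) S :=
    hY.ribbonCoeff hV
  replace hc := continuousOn_pi.1 (continuousOn_pi.1 hc i) j
  have hsq := fun s hs => ((hγ.isometric s hs).ribbonCoeff ht i j).1
  have hst : ribbonCoeff ((γ 0).frame t) ((γ 0).frameVel t) i j =
      ribbonCoeff (f.frame t) (f.frameVel t) i j := by
    rw [frame_congr hγ.start ht, frameVel_congr hγ.start ht]
  -- For fixed t, a vanishing coefficient stays zero by its square; otherwise a continuous function
  -- of s with constant nonzero square keeps its sign.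
  by_cases hz : ribbonCoeff (f.frame t) (f.frameVel t) i j = 0
  · have := hsq s hs
    rw [hz] at this ⊢
    simpa using this
  · exact hS.eq_of_sq_eq (g := fun _ => ribbonCoeff (f.frame t) (f.frameVel t) i j) hc
      continuousOn_const (fun s hs => hsq s hs) (fun _ => hz) h0 hst hs

end TwoRibbonSurface

/-- A vector of a fixed length can be moved so that its inner product with one of two given vectors
changes with unit speed and the other one does not change. -/
theorem exists_contDiffOn_inner_eq_add {u p q : Vec3} (hD : mixedProduct u p q ≠ 0) :
    ∃ r > 0, ∃ w : ℝ → Vec3, ContDiffOn ℝ ∞ w (Ioo (-r) r) ∧ w 0 = q ∧ ∀ s ∈ Ioo (-r) r,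
      inner ℝ u (w s) = inner ℝ u q ∧ inner ℝ p (w s) = inner ℝ p q + s ∧
        inner ℝ (w s) (w s) = inner ℝ q q := by
  set e := cross u p
  set N := inner ℝ e e
  have hN : N ≠ 0 := by
    have h := mixedProduct_cross_right_ne_zero hD
    rwa [← inner_cross] at h
  set D := mixedProduct u p q
  set d := N⁻¹ • cross e u
  have heu : inner ℝ u e = 0 := by
    simp only [e, inner_eq_sum_three, cross_zero, cross_one, cross_two]; ring
  have hep : inner ℝ p e = 0 := by
    simp only [e, inner_eq_sum_three, cross_zero, cross_one, cross_two]; ring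
  have heq : inner ℝ q e = D := by rw [real_inner_comm, inner_cross]
  have hdu : inner ℝ u d = 0 := by
    rw [inner_smul_right, real_inner_comm, inner_cross, mixedProduct_eq]; ring
  have hdp : inner ℝ p d = 1 := by
    rw [inner_smul_right, inv_mul_eq_one₀ hN]
    simp only [N, e, inner_eq_sum_three, cross_zero, cross_one, cross_two]; ring
  have hde : inner ℝ d e = 0 := by
    rw [inner_smul_left, inner_cross, mixedProduct_eq]; ring
  -- With w = q + s d + x e the two product conditions hold for every x. The length condition is a
  -- quadratic equation in x; m is its discriminant normalized to 1 at s = 0, and the root with x =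
  -- 0 at s = 0 is taken.
  set m : ℝ → ℝ := fun s => 1 - N * (2 * s * inner ℝ q d + s ^ 2 * inner ℝ d d) / D ^ 2
  have hm : ContDiff ℝ ∞ m := by fun_prop
  have hm0 : m 0 = 1 := by simp [m]
  obtain ⟨r, hr, hball⟩ := Metric.isOpen_iff.1
    (isOpen_lt continuous_const hm.continuous : IsOpen {s | 0 < m s}) 0
    (by rw [mem_ofPred_eq, hm0]; exact one_pos)
  rw [Real.ball_eq_Ioo, zero_sub, zero_add] at hball
  refine ⟨r, hr, fun s => q + s • d + (D / N * (√(m s) - 1)) • e, ?_, by simp [hm0], ?_⟩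
  · have hsq : ContDiffOn ℝ ∞ (fun s => √(m s)) (Ioo (-r) r) :=
      hm.contDiffOn.sqrt fun s hs => (hball hs).ne'
    have h1 : ContDiff ℝ ∞ fun s : ℝ => q + s • d := by fun_prop
    exact h1.contDiffOn.add ((contDiffOn_const.mul (hsq.sub contDiffOn_const)).smul
      contDiffOn_const)
  · intro s hs
    have hw : √(m s) ^ 2 = m s := Real.sq_sqrt (hball hs).le
    refine ⟨?_, ?_, ?_⟩
    · simp only [inner_add_right, inner_smul_right, heu, hdu]; ring
    · simp only [inner_add_right, inner_smul_right, hep, hdp]; ring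
    · have hqq : ∀ x : ℝ, inner ℝ (q + s • d + x • e) (q + s • d + x • e) =
          inner ℝ q q + (2 * s * inner ℝ q d + s ^ 2 * inner ℝ d d) + 2 * x * D + x ^ 2 * N := by
        intro x
        simp only [inner_add_right, inner_add_left, inner_smul_right, inner_smul_left,
          RCLike.conj_to_real, real_inner_comm q d, real_inner_comm q e, real_inner_comm d e,
          hde, heq]
        rw [real_inner_comm d q]
        ring
      rw [hqq]
      have h2 : 2 * (D / N * (√(m s) - 1)) * D + (D / N * (√(m s) - 1)) ^ 2 * N =
          D ^ 2 / N * (√(m s) ^ 2 - 1) := by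
        field_simp
        ring
      have h3 : D ^ 2 / N * (m s - 1) = -(2 * s * inner ℝ q d + s ^ 2 * inner ℝ d d) := by
        simp only [m]
        field_simp
        ring
      rw [add_assoc, h2, hw, h3, add_neg_cancel_right]

/-! ### Uniqueness of solutions -/

section Uniqueness

variable {a b : ℝ} {P E : Type} [NormedAddCommGroup P] [NormedSpace ℝ P]
  [NormedAddCommGroup E] [NormedSpace ℝ E]

/-- W is only locally Lipschitz, but it is Lipschitz on the compact union of the images of (c, Y)
and (c, Z), which is all that Grönwall's argument needs. -/
theorem eq_of_picardDefect_eq [CompleteSpace E] (hab : a ≤ b) {U : Set (P × E)}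
    (hU : IsOpen U) {W : P × E → E} (hW : ContDiffOn ℝ ∞ W U) (c : C(Icc a b, P))
    {Y Z : C(Icc a b, E)} (hY : ∀ t, (c t, Y t) ∈ U) (hZ : ∀ t, (c t, Z t) ∈ U) {y : E}
    (hYy : picardDefect hab W c Y = ContinuousMap.const _ y)
    (hZy : picardDefect hab W c Z = ContinuousMap.const _ y) : Y = Z := by
  set Q : Set (P × E) := range (c.prodMk Y) ∪ range (c.prodMk Z)
  have hQ : IsCompact Q :=
    (isCompact_range (c.prodMk Y).continuous).union (isCompact_range (c.prodMk Z).continuous)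
  have hQU : Q ⊆ U := by
    rintro _ (⟨t, rfl⟩ | ⟨t, rfl⟩)
    exacts [hY t, hZ t]
  have hlip : LocallyLipschitzOn Q W := by
    intro x hx
    have hx1 : ContDiffAt ℝ 1 W x :=
      (hW.contDiffAt (hU.mem_nhds (hQU hx))).of_le (by exact_mod_cast le_top)
    obtain ⟨L, s, hs, hL⟩ := hx1.exists_lipschitzOnWith
    exact ⟨L, s, mem_nhdsWithin_of_mem_nhds hs, hL⟩
  obtain ⟨L, hL⟩ := hlip.exists_lipschitzOnWith_of_compact hQ
  have hsol : ∀ X : C(Icc a b, E), (∀ t, (c t, X t) ∈ U) →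
      picardDefect hab W c X = ContinuousMap.const _ y →
      IccExtend hab X a = y ∧ ContinuousOn (IccExtend hab X) (Icc a b) ∧
      ∀ t ∈ Ico a b, HasDerivWithinAt (IccExtend hab X)
        (W (IccExtend hab c t, IccExtend hab X t)) (Ici t) t := by
    intro X hX hXy
    have hXt : ∀ t ∈ Icc a b, IccExtend hab X t =
        y + ∫ τ in a..t, IccExtend hab (superpose W (c.prodMk X)) τ := by
      intro t ht
      have := congrArg (fun h : C(Icc a b, E) => h ⟨t, ht⟩) hXy
      simp only [picardDefect, ContinuousMap.sub_apply, ContinuousMap.const_apply, sub_eq_iff_eq_add,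
        primitive_apply] at this
      rw [IccExtend_of_mem _ _ ht, this]
    refine ⟨by rw [hXt a ⟨le_rfl, hab⟩]; simp, X.continuous.Icc_extend'.continuousOn, ?_⟩
    intro t ht
    have ht' := Ico_subset_Icc_self ht
    have hd := ((hasDerivAt_integral_IccExtend hab (superpose W (c.prodMk X)) t).const_add
      y).hasDerivWithinAt (s := Ici t)
    rw [IccExtend_of_mem _ (superpose W (c.prodMk X)) ht',
      superpose_apply hW.continuousOn (f := c.prodMk X) hX] at hd
    rw [IccExtend_of_mem _ _ ht', IccExtend_of_mem _ _ ht']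
    refine hd.congr_of_eventuallyEq ?_ (hXt t ht')
    filter_upwards [Icc_mem_nhdsGE ht.2] with x hx
    exact hXt x ⟨ht.1.trans hx.1, hx.2⟩
  obtain ⟨hY0, hYc, hYd⟩ := hsol Y hY hYy
  obtain ⟨hZ0, hZc, hZd⟩ := hsol Z hZ hZy
  have heq := ODE_solution_unique_of_mem_Icc_right (K := L)
    (v := fun t x => W (IccExtend hab c t, x)) (s := fun t => {IccExtend hab Y t, IccExtend hab Z t})
    (fun t ht => ?_) hYc hYd (fun t _ => by simp) hZc hZd (fun t _ => by simp) (hY0.trans hZ0.symm)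
  · ext t
    simpa using heq t.2
  · have hmem : ∀ x ∈ ({IccExtend hab Y t, IccExtend hab Z t} : Set E),
        (IccExtend hab c t, x) ∈ Q := by
      rintro x (rfl | rfl)
      exacts [Or.inl ⟨_, rfl⟩, Or.inr ⟨_, rfl⟩]
    intro x hx x' hx'
    simpa [Prod.edist_eq] using hL (hmem x hx) (hmem x' hx')

end Uniqueness

/-! ### Surfaces as solutions of the equation of motion -/

namespace TwoRibbonSurface

variable {a b : ℝ} (f : TwoRibbonSurface a b)

/-- The coefficients of the motion of the moving basis. -/
noncomputable def coeffMap : C(Icc a b, Fin 3 → Fin 3 → ℝ) :=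
  ⟨fun t => ribbonCoeff (f.frame t) (f.frameVel t), continuousOn_iff_continuous_domRestrict.mp
    (f.continuousOn_frame.ribbonCoeff f.continuousOn_frameVel)⟩

@[simp] theorem coeffMap_apply (t : Icc a b) :
    f.coeffMap t = ribbonCoeff (f.frame t) (f.frameVel t) := rfl

variable {f}

theorem picardDefect_frameMap {g : TwoRibbonSurface a b}
    (hg : ∀ t : Icc a b, (f.coeffMap t, g.frameMap t) ∈ ribbonDomain)
    (hc : g.coeffMap = f.coeffMap) :
    picardDefect f.lt.le ribbonField f.coeffMap g.frameMap =
      ContinuousMap.const _ (g.frame a) := by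
  have h : superpose ribbonField (f.coeffMap.prodMk g.frameMap) = g.frameVelMap := by
    ext t : 1
    rw [superpose_apply contDiffOn_ribbonField.continuousOn (f := f.coeffMap.prodMk g.frameMap) hg,
      ← hc]
    exact ribbonField_ribbonCoeff (hg t) _
  rw [picardDefect, h, sub_eq_iff_eq_add]
  exact g.frameMap_eq_add_primitive

/-- A solution of the equation of motion of the moving basis is the moving basis of a surface. -/
theorem surfaceOfFrame_of_picardDefect_eq (x₀ : Vec3) {Y : C(Icc a b, Fin 3 → Vec3)}
    (hY : ∀ t, (f.coeffMap t, Y t) ∈ ribbonDomain) {y : Fin 3 → Vec3}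
    (hy : picardDefect f.lt.le ribbonField f.coeffMap Y = ContinuousMap.const _ y)
    {g : TwoRibbonSurface a b}
    (hg : g = surfaceOfFrame f.lt x₀ y (superpose ribbonField (f.coeffMap.prodMk Y))) :
    g.frameMap = Y ∧ g.frameVelMap = superpose ribbonField (f.coeffMap.prodMk Y) ∧
      g.coeffMap = f.coeffMap ∧ g.frame a = y := by
  rw [picardDefect, sub_eq_iff_eq_add] at hy
  have h1 : g.frameMap = Y := by
    rw [hg]
    ext t : 1
    refine (surfaceOfFrame_frame _ _ _ _ t.2).trans ?_
    exact (congrArg (fun h : C(Icc a b, Fin 3 → Vec3) => h t) hy).symm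
  have h2 : g.frameVelMap = superpose ribbonField (f.coeffMap.prodMk Y) := by
    rw [hg]
    ext t : 1
    exact surfaceOfFrame_frameVel _ _ _ _ t.2
  refine ⟨h1, h2, ?_, ?_⟩
  · ext t : 1
    rw [coeffMap_apply, ← frameMap_apply, ← frameVelMap_apply, h1, h2,
      superpose_apply contDiffOn_ribbonField.continuousOn (f := f.coeffMap.prodMk Y) hY]
    exact ribbonCoeff_ribbonField (hY t) _
  · rw [hg, surfaceOfFrame_frame _ _ _ _ (left_mem_Icc.2 f.lt.le)]
    simp [curveOfVelocity]

end TwoRibbonSurface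

/-! ### Congruence of surfaces -/

namespace TwoRibbonSurface

variable {a b : ℝ} {f g : TwoRibbonSurface a b}

/-- The image of a surface under a linear isometry. -/
noncomputable def map (R : Vec3 ≃ₗᵢ[ℝ] Vec3) (g : TwoRibbonSurface a b) :
    TwoRibbonSurface a b where
  lt := g.lt
  curve i t := R (g.curve i t)
  contDiffOn i := R.contDiff.comp_contDiffOn (g.contDiffOn i)

theorem hasDerivWithinAt_isometry (R : Vec3 ≃ₗᵢ[ℝ] Vec3) {F : ℝ → Vec3} {F' : Vec3} {S : Set ℝ}
    {t : ℝ} (h : HasDerivWithinAt F F' S t) : HasDerivWithinAt (fun x => R (F x)) (R F') S t :=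
  (R.toContinuousLinearEquiv : Vec3 →L[ℝ] Vec3).hasFDerivAt.comp_hasDerivWithinAt t h

theorem vel_map (R : Vec3 ≃ₗᵢ[ℝ] Vec3) (i : Fin 3) {t : ℝ} (ht : t ∈ Icc a b) :
    (g.map R).vel i t = R (g.vel i t) :=
  (hasDerivWithinAt_isometry R (g.hasDerivWithinAt_curve i ht)).derivWithin
    (uniqueDiffOn_Icc g.lt t ht)

theorem frame_map (R : Vec3 ≃ₗᵢ[ℝ] Vec3) {t : ℝ} (ht : t ∈ Icc a b) :
    (g.map R).frame t = fun i => R (g.frame t i) := by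
  funext i
  fin_cases i
  · exact vel_map R 1 ht
  · exact (map_sub R _ _).symm
  · exact (map_sub R _ _).symm

theorem frameVel_map (R : Vec3 ≃ₗᵢ[ℝ] Vec3) {t : ℝ} (ht : t ∈ Icc a b) :
    (g.map R).frameVel t = fun i => R (g.frameVel t i) := by
  refine (uniqueDiffOn_Icc g.lt t ht).eq_deriv _ ((g.map R).hasDerivWithinAt_frame ht) ?_
  have h := hasDerivWithinAt_pi.1 (g.hasDerivWithinAt_frame ht)
  exact (hasDerivWithinAt_pi.2 fun i => hasDerivWithinAt_isometry R (h i)).congr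
    (fun x hx => frame_map R hx) (frame_map R ht)

theorem coeffMap_map {R : Vec3 ≃ₗᵢ[ℝ] Vec3}
    (hR : ∀ u v w, mixedProduct (R u) (R v) (R w) = mixedProduct u v w) :
    (g.map R).coeffMap = g.coeffMap := by
  ext t : 1
  rw [coeffMap_apply, frame_map R t.2, frameVel_map R t.2, ribbonCoeff_map hR, coeffMap_apply]

/-- Surfaces whose moving bases differ by a linear isometry differ by an affine isometry. -/
theorem curve_eq_of_frame_eq (R : Vec3 ≃ₗᵢ[ℝ] Vec3)
    (h : ∀ t ∈ Icc a b, ∀ i, g.frame t i = R (f.frame t i)) (i : Fin 3) {t : ℝ}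
    (ht : t ∈ Icc a b) :
    g.curve i t = R (f.curve i t) + (g.curve 1 a - R (f.curve 1 a)) := by
  have h1 : g.curve 1 t = R (f.curve 1 t) + (g.curve 1 a - R (f.curve 1 a)) := by
    have hf := eq_add_primitive f.lt.le (F := fun t => R (f.curve 1 t))
      (V := component 0 g.frameMap) (fun x hx =>
        (hasDerivWithinAt_isometry R (f.hasDerivWithinAt_curve 1 hx)).congr_deriv
          (h x hx 0).symm) ht
    rw [g.curve_one_eq_add_primitive ht, hf]
    abel
  have h2 : g.curve 1 t - g.curve 0 t = R (f.curve 1 t - f.curve 0 t) := h t ht 1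
  have h3 : g.curve 2 t - g.curve 1 t = R (f.curve 2 t - f.curve 1 t) := h t ht 2
  rw [map_sub] at h2 h3
  fin_cases i
  · change g.curve 0 t = R (f.curve 0 t) + _
    rw [sub_eq_iff_eq_add, h1] at h2
    rw [← sub_eq_zero]
    rw [← sub_eq_zero] at h2
    rw [← neg_eq_zero, ← h2]
    abel
  · exact h1
  · change g.curve 2 t = R (f.curve 2 t) + _
    rw [sub_eq_iff_eq_add, h1] at h3
    rw [h3]
    abel

theorem isCongruent_of_frame_eq (R : Vec3 ≃ₗᵢ[ℝ] Vec3)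
    (h : ∀ t ∈ Icc a b, ∀ i, g.frame t i = R (f.frame t i)) : IsCongruent f g :=
  ⟨R.toIsometryEquiv.trans (IsometryEquiv.addRight (g.curve 1 a - R (f.curve 1 a))),
    fun i _ ht => curve_eq_of_frame_eq R h i ht⟩

/-- By polarization the product is a function of the three distances between the points of the
curves at t, which any isometry preserves, even one that reverses orientation. -/
theorem IsCongruent.inner_diff_eq (h : IsCongruent f g) {t : ℝ} (ht : t ∈ Icc a b) :
    inner ℝ (g.frame t 1) (g.frame t 2) = inner ℝ (f.frame t 1) (f.frame t 2) := by
  obtain ⟨T, hT⟩ := h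
  have hd : ∀ i j, ‖g.curve i t - g.curve j t‖ = ‖f.curve i t - f.curve j t‖ := by
    intro i j
    rw [hT i t ht, hT j t ht, ← dist_eq_norm, T.dist_eq, dist_eq_norm]
  have key : ∀ S : TwoRibbonSurface a b, inner ℝ (S.frame t 1) (S.frame t 2) =
      (‖S.curve 2 t - S.curve 0 t‖ * ‖S.curve 2 t - S.curve 0 t‖
        - ‖S.curve 1 t - S.curve 0 t‖ * ‖S.curve 1 t - S.curve 0 t‖
        - ‖S.curve 2 t - S.curve 1 t‖ * ‖S.curve 2 t - S.curve 1 t‖) / 2 := by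
    intro S
    have h := real_inner_eq_norm_add_mul_self_sub_norm_mul_self_sub_norm_mul_self_div_two
      (S.curve 1 t - S.curve 0 t) (S.curve 2 t - S.curve 1 t)
    rw [sub_add_sub_cancel'] at h
    exact h
  rw [key, key, hd, hd, hd]

end TwoRibbonSurface

/-! ### The one-parameter family and its universality -/

namespace TwoRibbonSurface

variable {a b : ℝ}

open Filter Topology in
/-- A family of isometric surfaces with moving bases that depend smoothly on the inner product of
`Δf₀` and `Δf₁` at the left end. -/
theorem exists_isometric_family (f : TwoRibbonSurface a b)
    (hf : ∀ t : Icc a b, (f.coeffMap t, f.frameMap t) ∈ ribbonDomain) :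
    ∃ ρ : ℝ, 0 < ρ ∧ ∃ Γ : ℝ → TwoRibbonSurface a b, f.IsFlexion ∞ (Ioo (-ρ) ρ) Γ ∧
      ∀ s ∈ Ioo (-ρ) ρ, (Γ s).coeffMap = f.coeffMap ∧
        (∀ t : Icc a b, (f.coeffMap t, (Γ s).frameMap t) ∈ ribbonDomain) ∧
        inner ℝ ((Γ s).frame a 1) ((Γ s).frame a 2) = inner ℝ (f.frame a 1) (f.frame a 2) + s ∧
        0 < mixedProduct ((Γ s).frame a 0) ((Γ s).frame a 1) ((Γ s).frame a 2) *
          mixedProduct (f.frame a 0) (f.frame a 1) (f.frame a 2) := by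
  have ha : a ∈ Icc a b := left_mem_Icc.2 f.lt.le
  have hD : mixedProduct (f.frame a 0) (f.frame a 1) (f.frame a 2) ≠ 0 := hf ⟨a, ha⟩
  obtain ⟨N, hN, Y, hYN, hYf, hY⟩ := exists_contDiffOn_integral_curves f.lt.le isOpen_ribbonDomain
    contDiffOn_ribbonField f.coeffMap hf (picardDefect_frameMap hf rfl)
  obtain ⟨r, hr, w, hw, hw0, hwi⟩ := exists_contDiffOn_inner_eq_add hD
  -- Only Δf₁(a) is moved, keeping its length and its product with ḟ₁(a), so that ⟨Δf₀, Δf₁⟩(a)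
  -- grows by exactly s.
  set y : ℝ → Fin 3 → Vec3 := fun s => ![f.frame a 0, f.frame a 1, w s]
  have hy : ContDiffOn ℝ ∞ y (Ioo (-r) r) := by
    refine contDiffOn_pi.2 fun i => ?_
    fin_cases i
    exacts [contDiffOn_const, contDiffOn_const, hw]
  have hy0 : y 0 = f.frame a := by
    funext i
    fin_cases i
    exacts [rfl, rfl, hw0]
  have hyc : ContinuousAt y 0 :=
    hy.continuousOn.continuousAt (Ioo_mem_nhds (neg_lt_zero.2 hr) hr)
  have hmc : Continuous fun z : Fin 3 → Vec3 => mixedProduct (z 0) (z 1) (z 2) *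
      mixedProduct (f.frame a 0) (f.frame a 1) (f.frame a 2) := by
    have h : ContDiff ℝ 0 fun z : Fin 3 → Vec3 => mixedProduct (z 0) (z 1) (z 2) := by fun_prop
    exact h.continuous.mul continuous_const
  obtain ⟨O, hOdef⟩ : ∃ O : Set (Fin 3 → Vec3), O = {z | 0 < mixedProduct (z 0) (z 1) (z 2) *
      mixedProduct (f.frame a 0) (f.frame a 1) (f.frame a 2)} := ⟨_, rfl⟩
  have hO : IsOpen O := hOdef ▸ isOpen_lt continuous_const hmc
  have hfO : f.frame a ∈ O := hOdef ▸ mul_self_pos.2 hD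
  have hev : ∀ᶠ s in 𝓝 (0 : ℝ), s ∈ Ioo (-r) r ∧ y s ∈ N ∧ y s ∈ O := by
    have hIoo : ∀ᶠ s in 𝓝 (0 : ℝ), s ∈ Ioo (-r) r := Ioo_mem_nhds (neg_lt_zero.2 hr) hr
    exact hIoo.and ((hyc.eventually_mem (by rwa [hy0])).and
      (hyc.eventually_mem (hO.mem_nhds (by rwa [hy0]))))
  obtain ⟨ρ, hρ, hball⟩ := Metric.eventually_nhds_iff_ball.1 hev
  rw [Real.ball_eq_Ioo, zero_sub, zero_add] at hball
  set V : ℝ → C(Icc a b, Fin 3 → Vec3) := fun s =>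
    superpose ribbonField (f.coeffMap.prodMk (Y (y s)))
  set Γ : ℝ → TwoRibbonSurface a b := fun s => surfaceOfFrame f.lt (f.curve 1 a) (y s) (V s)
  have hΓ : ∀ s ∈ Ioo (-ρ) ρ, (Γ s).frameMap = Y (y s) ∧ (Γ s).frameVelMap = V s ∧
      (Γ s).coeffMap = f.coeffMap ∧ (Γ s).frame a = y s := by
    intro s hs
    obtain ⟨h1, h2⟩ := hY _ (hball s hs).2.1
    exact surfaceOfFrame_of_picardDefect_eq (f.curve 1 a) h1 h2 rfl
  have hΓa : ∀ s, (Γ s).curve 1 a = f.curve 1 a := fun s => surfaceOfFrame_curve_one_left _ _ _ _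
  refine ⟨ρ, hρ, Γ, ⟨?_, ?_, ?_⟩, ?_⟩
  · intro i t ht
    have h0 : (Γ 0).frameMap = f.frameMap := by
      rw [(hΓ 0 ⟨neg_lt_zero.2 hρ, hρ⟩).1, hy0, hYf]
    have h := curve_eq_of_frame_eq (f := f) (g := Γ 0) (LinearIsometryEquiv.refl ℝ Vec3)
      (fun t ht i => congrFun (congrArg (fun F : C(Icc a b, Fin 3 → Vec3) => F ⟨t, ht⟩) h0) i) i ht
    rw [h, hΓa]
    simp
  · have hYy : ContDiffOn ℝ ∞ (fun s => Y (y s)) (Ioo (-ρ) ρ) :=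
      hYN.comp (hy.mono fun s hs => (hball s hs).1) fun s hs => (hball s hs).2.1
    refine isCurveOfClass_of_frameMap (contDiffOn_const.congr fun s _ => hΓa s)
      (hYy.congr fun s hs => (hΓ s hs).1) ?_
    have h1 : ContDiffOn ℝ ∞ (fun s => f.coeffMap.prodMk (Y (y s))) (Ioo (-ρ) ρ) :=
      (contDiff_pairing_left f.coeffMap).1.comp_contDiffOn hYy
    have h2 : ContDiffOn ℝ ∞ V (Ioo (-ρ) ρ) :=
      (contDiffOn_superpose isOpen_ribbonDomain contDiffOn_ribbonField).comp h1
        fun s hs => (hY _ (hball s hs).2.1).1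
    exact h2.congr fun s hs => (hΓ s hs).2.1
  · intro s hs
    obtain ⟨-, -, h3, h4⟩ := hΓ s hs
    obtain ⟨w1, w2, w3⟩ := hwi s (hball s hs).1
    refine sameInnerGeometry_of_ribbonCoeff_eq (fun t ht => hf ⟨t, ht⟩)
      (fun t ht => congrArg (fun F : C(Icc a b, Fin 3 → Fin 3 → ℝ) => F ⟨t, ht⟩) h3)
      ?_ ?_ ?_ ?_ ?_ <;> rw [h4]
    exacts [rfl, rfl, w3, rfl, w1]
  · intro s hs
    obtain ⟨h1, -, h3, h4⟩ := hΓ s hs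
    refine ⟨h3, ?_, ?_, ?_⟩
    · rw [h1]
      exact (hY _ (hball s hs).2.1).1
    · rw [h4]
      exact (hwi s (hball s hs).1).2.1
    · rw [h4]
      have h := (hball s hs).2.2
      rwa [hOdef] at h

/-- Surfaces with the same coefficients of motion and with congruent initial moving bases are
congruent. -/
theorem isCongruent_of_coeffMap_eq {f g h : TwoRibbonSurface a b} (hg : g.coeffMap = f.coeffMap)
    (hh : h.coeffMap = f.coeffMap)
    (hgU : ∀ t : Icc a b, (f.coeffMap t, g.frameMap t) ∈ ribbonDomain)
    (hhU : ∀ t : Icc a b, (f.coeffMap t, h.frameMap t) ∈ ribbonDomain)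
    (hgram : ∀ i j, inner ℝ (g.frame a i) (g.frame a j) = inner ℝ (h.frame a i) (h.frame a j))
    (hD : 0 < mixedProduct (g.frame a 0) (g.frame a 1) (g.frame a 2) *
      mixedProduct (h.frame a 0) (h.frame a 1) (h.frame a 2)) : IsCongruent g h := by
  have ha : a ∈ Icc a b := left_mem_Icc.2 f.lt.le
  -- After this rotation the initial bases coincide and uniqueness applies. Orientation matters: a
  -- reflection would change the sign of the coefficients built from cross products.
  obtain ⟨R, hR, hRm⟩ := exists_rotation hgram hD
  have hRU : ∀ t : Icc a b, (f.coeffMap t, (g.map R).frameMap t) ∈ ribbonDomain := by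
    intro t
    have := hgU t
    rw [ribbonDomain, mem_ofPred_eq] at this ⊢
    rw [frameMap_apply, frame_map R t.2]
    rwa [hRm]
  have hRa : (g.map R).frame a = h.frame a := by
    rw [frame_map R ha]
    exact funext hR
  have h1 := picardDefect_frameMap hRU ((coeffMap_map hRm).trans hg)
  have h2 := picardDefect_frameMap hhU hh
  rw [hRa] at h1
  have heq := eq_of_picardDefect_eq f.lt.le isOpen_ribbonDomain contDiffOn_ribbonField f.coeffMap
    hRU hhU h1 h2
  refine isCongruent_of_frame_eq R fun t ht i => ?_
  have h3 : (g.map R).frame t = h.frame t :=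
    congrArg (fun F : C(Icc a b, Fin 3 → Vec3) => F ⟨t, ht⟩) heq
  rw [← h3, frame_map R ht]

theorem SameInnerGeometry.gram_eq {f g h : TwoRibbonSurface a b} (hg : SameInnerGeometry f g)
    (hh : SameInnerGeometry f h) {t : ℝ} (ht : t ∈ Icc a b)
    (h12 : inner ℝ (g.frame t 1) (g.frame t 2) = inner ℝ (h.frame t 1) (h.frame t 2)) (i j : Fin 3) :
    inner ℝ (g.frame t i) (g.frame t j) = inner ℝ (h.frame t i) (h.frame t j) := by
  have h1 := sameInnerGeometry_iff.1 hg t ht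
  have h2 := sameInnerGeometry_iff.1 hh t ht
  have e01 := h1.gram_zero_one.trans h2.gram_zero_one.symm
  have e02 := h1.gram_zero_two.trans h2.gram_zero_two.symm
  have swap : ∀ i j : Fin 3, inner ℝ (g.frame t i) (g.frame t j) =
      inner ℝ (h.frame t i) (h.frame t j) →
      inner ℝ (g.frame t j) (g.frame t i) = inner ℝ (h.frame t j) (h.frame t i) := by
    intro i j h
    rw [real_inner_comm, h, real_inner_comm]
  fin_cases i <;> fin_cases j
  exacts [h1.gram_zero_zero.trans h2.gram_zero_zero.symm, e01, e02, swap 0 1 e01,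
    h1.gram_one_one.trans h2.gram_one_one.symm, h12, swap 0 2 e02, swap 1 2 h12,
    h1.gram_two_two.trans h2.gram_two_two.symm]

theorem IsFlexion.frameMap_zero {f : TwoRibbonSurface a b} {k : WithTop ℕ∞} {S : Set ℝ}
    {γ : ℝ → TwoRibbonSurface a b} (hγ : f.IsFlexion k S γ) : (γ 0).frameMap = f.frameMap := by
  ext t : 1
  exact frame_congr hγ.start t.2

open Filter Topology in
theorem IsFlexion.eventually_frameMap_mem {f : TwoRibbonSurface a b} {k : WithTop ℕ∞} {S : Set ℝ}
    {γ : ℝ → TwoRibbonSurface a b} (hγ : f.IsFlexion k S γ) (h0 : 0 ∈ S)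
    {O : Set C(Icc a b, Fin 3 → Vec3)} (hO : IsOpen O) (hf : f.frameMap ∈ O) :
    ∀ᶠ s in 𝓝[S] 0, (γ s).frameMap ∈ O :=
  (hγ.smooth.contDiffOn_frameMap.continuousOn 0 h0).eventually
    (hO.mem_nhds (by simpa only [hγ.frameMap_zero] using hf))

end TwoRibbonSurface

open TwoRibbonSurface Filter Topology in
theorem mainTheorem1 {a b : ℝ} (f : TwoRibbonSurface a b)
    (hf : ∀ t ∈ Icc a b, mixedProduct (f.vel 1 t) (f.diff 0 t) (f.diff 1 t) ≠ 0) :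
    ∃ ρ : ℝ, 0 < ρ ∧ ∃ Γ : ℝ → TwoRibbonSurface a b,
      f.IsFlexion ∞ (Ioo (-ρ) ρ) Γ ∧
      (∀ s ∈ Ioo (-ρ) ρ, ∀ s' ∈ Ioo (-ρ) ρ, (Γ s).IsCongruent (Γ s') → s = s') ∧
      ∀ (k : ℕ∞) (ε : ℝ) (γ : ℝ → TwoRibbonSurface a b), 0 < ε →
        f.IsFlexion k (Icc 0 ε) γ →
        ∃ δ : ℝ, 0 < δ ∧ δ ≤ ε ∧ ∃ φ : ℝ → ℝ,
          ContDiffOn ℝ k φ (Icc 0 δ) ∧ φ 0 = 0 ∧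
          ∀ s ∈ Icc 0 δ, φ s ∈ Ioo (-ρ) ρ ∧ (γ s).IsCongruent (Γ (φ s)) := by
  have ha : a ∈ Icc a b := left_mem_Icc.2 f.lt.le
  have hU : ∀ t : Icc a b, (f.coeffMap t, f.frameMap t) ∈ ribbonDomain := fun t => hf t t.2
  obtain ⟨ρ, hρ, Γ, hflex, hΓ⟩ := f.exists_isometric_family hU
  refine ⟨ρ, hρ, Γ, hflex, ?_, ?_⟩
  · intro s hs s' hs' hc
    have h := hc.inner_diff_eq ha
    rw [(hΓ s hs).2.2.1, (hΓ s' hs').2.2.1] at h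
    linarith
  · intro k ε γ hε hγ
    have h0 : (0 : ℝ) ∈ Icc 0 ε := left_mem_Icc.2 hε.le
    have hev : Continuous fun Y : C(Icc a b, Fin 3 → Vec3) => Y ⟨a, ha⟩ :=
      continuous_eval_const (⟨a, ha⟩ : Icc a b)
    -- The parameter of Γ read off a moving basis. It is a quadratic polynomial in evaluations,
    -- hence smooth, so φ inherits the class of γ.
    set ψ : C(Icc a b, Fin 3 → Vec3) → ℝ := fun Y =>
      inner ℝ (Y ⟨a, ha⟩ 1) (Y ⟨a, ha⟩ 2) - inner ℝ (f.frame a 1) (f.frame a 2)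
    have hψ : ContDiff ℝ k ψ := by
      have hi : ∀ i, ContDiff ℝ k fun Y : C(Icc a b, Fin 3 → Vec3) => Y ⟨a, ha⟩ i := fun i =>
        ((ContinuousMap.evalCLM ℝ (⟨a, ha⟩ : Icc a b)).comp
          (component i : C(Icc a b, Fin 3 → Vec3) →L[ℝ] C(Icc a b, Vec3))).contDiff
      exact ((hi 1).inner ℝ (hi 2)).sub contDiff_const
    have hψf : ψ f.frameMap = 0 := sub_self _
    have hD : Continuous fun Y : C(Icc a b, Fin 3 → Vec3) =>
        mixedProduct (Y ⟨a, ha⟩ 0) (Y ⟨a, ha⟩ 1) (Y ⟨a, ha⟩ 2) *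
          mixedProduct (f.frame a 0) (f.frame a 1) (f.frame a 2) := by
      have h : ContDiff ℝ 0 fun z : Fin 3 → Vec3 => mixedProduct (z 0) (z 1) (z 2) := by fun_prop
      exact (h.continuous.comp hev).mul continuous_const
    have e1 := hγ.eventually_frameMap_mem h0 (isOpen_Ioo.preimage hψ.continuous)
      (by rw [mem_preimage, hψf]; exact ⟨neg_lt_zero.2 hρ, hρ⟩ : f.frameMap ∈ ψ ⁻¹' Ioo (-ρ) ρ)
    have e2 := hγ.eventually_frameMap_mem h0 (isOpen_forall_prodMk_mem isOpen_ribbonDomain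
      f.coeffMap) hU
    have e3 := hγ.eventually_frameMap_mem h0 (isOpen_Ioi.preimage hD)
      (mul_self_pos.2 (hf a ha))
    obtain ⟨η, hη, hsub⟩ := Metric.mem_nhdsWithin_iff.1 (e1.and (e2.and e3))
    have hle : min (η / 2) ε ≤ ε := min_le_right _ _
    refine ⟨min (η / 2) ε, lt_min (half_pos hη) hε, hle, fun s => ψ (γ s).frameMap,
      (hψ.comp_contDiffOn hγ.smooth.contDiffOn_frameMap).mono (Icc_subset_Icc_right hle), ?_, ?_⟩
    · simp only [hγ.frameMap_zero, hψf]
    · intro s hs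
      have hsε : s ∈ Icc 0 ε := Icc_subset_Icc_right hle hs
      have hsη : s ∈ Metric.ball 0 η := by
        rw [mem_ball_zero_iff, Real.norm_of_nonneg hs.1]
        exact (hs.2.trans (min_le_left _ _)).trans_lt (half_lt_self hη)
      obtain ⟨d1, d2, d3⟩ := hsub ⟨hsη, hsε⟩
      refine ⟨d1, ?_⟩
      obtain ⟨c1, c2, c3, c4⟩ := hΓ _ d1
      have hcoeff : (γ s).coeffMap = f.coeffMap := by
        ext t : 1
        exact hγ.ribbonCoeff_eq isPreconnected_Icc h0 hsε t.2
      refine isCongruent_of_coeffMap_eq hcoeff c1 d2 c2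
        ((hγ.isometric s hsε).gram_eq (hflex.isometric _ d1) ha ?_) ?_
      · rw [c3]
        exact (add_sub_cancel _ _).symm
      · have h := mul_pos d3 c4
        -- Both orientations were compared with that of f; the square of the mixed product of f at a
        -- cancels.
        refine (mul_pos_iff_of_pos_right (sq_pos_of_ne_zero (hf a ha))).1 (h.trans_eq ?_)
        change _ * mixedProduct (f.vel 1 a) (f.diff 0 a) (f.diff 1 a) *
          (_ * mixedProduct (f.vel 1 a) (f.diff 0 a) (f.diff 1 a)) = _
        simp only [frameMap_apply]
        ring
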